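/- **Setting.** Let $I\subset\mathbb R$ be a non-degenerate compact interval and let $(I_j)_j$, $I_j=(p_j,q_j)$, be a finite or countable family of pairwise disjoint non-empty open subintervals of $I$. A map $f:\bigcup_j I_j\to I$ is a *cusp map* if - for each $j$, $f$ is a $C^1$ diffeomorphism from $I_j$ onto $f(I_j)$, and the limits $\lim_{x\to p_j^+}Df(x)$ and $\lim_{x\to q_j^-}Df(x)$ exist and equal $0$ or $\pm\infty$; - there are constants $C,\epsilon>0$ such that, for every $j$ and all $x,x'\in I_j$: if $|Df(x)|,|Df(x')|\le 2$ then $|Df(x)-Df(x')|\le C|x-x'|^\epsilon$, and if $|Df(x)|,|Df(x')|\ge \tfrac12$ then $\left|\frac1{Df(x)}-\frac1{Df(x')}\right|\le C|x-x'|^\epsilon$. Let $\mu$ be an ergodic $f$-invariant Borel probability measure such that $\log|Df|$ is $\mu$-integrable, with positive Lyapunov exponent $\chi=\int\log|Df|\,d\mu>0$. Let $Y=\{y=(y_0,y_1,y_2,\dots): f(y_{i+1})=y_i \text{ for all } i\ge 0\}$, let $F^{-1}:Y\to Y$ be the map $(y_0,y_1,\dots)\mapsto(y_1,y_2,\dots)$,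 with inverse $F:F^{-1}(Y)\to Y$, let $\Pi:Y\to I$, $\Pi(y)=y_0$, and let $\bar\mu$ be the unique $F$-invariant measure on $Y$ with $\Pi_*\bar\mu=\mu$; $(Y,F,\bar\mu)$ is the *natural extension* of $(f,\mu)$. **Theorem.** There exist a measurable function $\alpha$ on $Y$ with $0<\alpha<1/2$ $\bar\mu$-almost everywhere and, for each $\eta>0$, a measurable function $\rho=\rho_\eta$ on $Y$ with $0<\rho<\infty$ $\bar\mu$-almost everywhere, such that for $\bar\mu$-almost every $y\in Y$ there exists a set $V_y\subset Y$ with the following properties: - $y\in V_y$ and $\Pi V_y=B(\Pi y,\alpha(y))$, the open ball of centre $\Pi y$ and radius $\alpha(y)$; - for each $n>0$, $f^n:\Pi F^{-n}V_y\to\Pi V_y$ is a $C^1$ diffeomorphism (in particular it is onto); - for all $y'\in V_y$, $$\sum_{i=1}^\infty\bigl|\log|Df(\Pi F^{-i}y')|-\log|Df(\Pi F^{-i}y)|\bigr|<\log 2;$$ - for every $\eta>0$ and every integer $n\ge 0$, $$\rho_\eta(y)^{-1}e^{n(\chi-\eta)}<|Df^n(\Pi F^{-n}y)|<\rho_\eta(y)e^{n(\chi+\eta)},$$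 and the length satisfies $|\Pi F^{-n}V_y|\le\rho_\eta(y)e^{-n(\chi-\eta)}$. -/

import Mathlib

open MeasureTheory Set Filter Topology

/-- `f` restricts to a `C¹` diffeomorphism from the open set `U` of the line onto the open set
`V`. -/
def IsC1Diffeo (f : ℝ → ℝ) (U V : Set ℝ) : Prop :=
  IsOpen U ∧ IsOpen V ∧ BijOn f U V ∧ ContDiffOn ℝ 1 f U ∧
    ∃ g : ℝ → ℝ, InvOn g f U V ∧ ContDiffOn ℝ 1 g V

/-- The domain of definition `⋃ⱼ Iⱼ` of the map, where `Iⱼ = (pⱼ, qⱼ)`. -/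
def cuspDomain {ι : Type*} (p q : ι → ℝ) : Set ℝ := ⋃ j, Ioo (p j) (q j)

/-- The limit of `φ` along `l` exists and equals `0`, `+∞` or `-∞`. -/
def LimZeroOrInfinite (φ : ℝ → ℝ) (l : Filter ℝ) : Prop :=
  Tendsto φ l (𝓝 0) ∨ Tendsto φ l atTop ∨ Tendsto φ l atBot

/-- `f : ⋃ⱼ (pⱼ, qⱼ) → I = [a, b]` is a basic cusp map. The partially defined map is represented
by a total function `f : ℝ → ℝ`, whose values outside `⋃ⱼ (pⱼ, qⱼ)` are irrelevant. -/
structure IsBasicCuspMap {ι : Type*} (a b : ℝ) (p q : ι → ℝ) (f : ℝ → ℝ) : Prop where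
  left_lt_right : a < b
  nonempty : ∀ j, p j < q j
  subset : ∀ j, Ioo (p j) (q j) ⊆ Icc a b
  pairwise_disjoint : Pairwise fun i j => Disjoint (Ioo (p i) (q i)) (Ioo (p j) (q j))
  mapsTo : ∀ j, MapsTo f (Ioo (p j) (q j)) (Icc a b)
  diffeo : ∀ j, IsC1Diffeo f (Ioo (p j) (q j)) (f '' Ioo (p j) (q j))
  lim_left : ∀ j, LimZeroOrInfinite (deriv f) (𝓝[>] p j)
  lim_right : ∀ j, LimZeroOrInfinite (deriv f) (𝓝[<] q j)

/-- `f : ⋃ⱼ (pⱼ, qⱼ) → [a, b]` is a cusp map with constants `C`, `ε`. -/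
structure IsCuspMapWith {ι : Type*} (a b : ℝ) (p q : ι → ℝ) (f : ℝ → ℝ) (C ε : ℝ) : Prop where
  basic : IsBasicCuspMap a b p q f
  C_pos : 0 < C
  ε_pos : 0 < ε
  holder : ∀ j, ∀ x ∈ Ioo (p j) (q j), ∀ x' ∈ Ioo (p j) (q j),
    |deriv f x| ≤ 2 → |deriv f x'| ≤ 2 → |deriv f x - deriv f x'| ≤ C * |x - x'| ^ ε
  holder_inv : ∀ j, ∀ x ∈ Ioo (p j) (q j), ∀ x' ∈ Ioo (p j) (q j),
    2⁻¹ ≤ |deriv f x| → 2⁻¹ ≤ |deriv f x'| →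
      |1 / deriv f x - 1 / deriv f x'| ≤ C * |x - x'| ^ ε

/-- `f : ⋃ⱼ (pⱼ, qⱼ) → [a, b]` is a cusp map. -/
def IsCuspMap {ι : Type*} (a b : ℝ) (p q : ι → ℝ) (f : ℝ → ℝ) : Prop :=
  ∃ C ε : ℝ, IsCuspMapWith a b p q f C ε

/-- `μ` is invariant under the partially defined map `T : D → X`: one has `μ(T⁻¹ A) = μ(A)` for
every measurable `A`, where `T⁻¹ A = {x ∈ D | T x ∈ A}`. (Taking `A = X`, a finite invariant measure
gives no mass to the complement of `D`.) -/
def IsInvariantOn {X : Type*} [MeasurableSpace X] (D : Set X) (T : X → X) (μ : Measure X) : Prop :=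
  ∀ A, MeasurableSet A → μ (D ∩ T ⁻¹' A) = μ A

/-- `μ` is an ergodic invariant probability measure of the partially defined map `T : D → X`. -/
structure IsErgodicInvariant {X : Type*} [MeasurableSpace X] (D : Set X) (T : X → X)
    (μ : Measure X) : Prop where
  prob : IsProbabilityMeasure μ
  invariant : IsInvariantOn D T μ
  ergodic : ∀ A, MeasurableSet A → D ∩ T ⁻¹' A = A → μ A = 0 ∨ μ A = 1

/-- The space `Y` of backward orbits `y = (y₀, y₁, y₂, …)`, `f(yᵢ₊₁) = yᵢ`, of the partially defined
map `f : D → ℝ`, with the σ-algebra induced by the product `ℝ^ℕ`. -/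
abbrev BackwardOrbit (D : Set ℝ) (f : ℝ → ℝ) : Type :=
  {y : ℕ → ℝ // ∀ i, y (i + 1) ∈ D ∧ f (y (i + 1)) = y i}

namespace BackwardOrbit

variable {D : Set ℝ} {f : ℝ → ℝ}

/-- The projection `Π : Y → ℝ`, `(y₀, y₁, …) ↦ y₀`. -/
def proj (y : BackwardOrbit D f) : ℝ := y.1 0

/-- The map `F⁻¹ : Y → Y`, `(y₀, y₁, …) ↦ (y₁, y₂, …)`. -/
def Finv (y : BackwardOrbit D f) : BackwardOrbit D f := ⟨fun i => y.1 (i + 1), fun i => y.2 (i + 1)⟩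

/-- The domain of definition of `F`, which is the set `F⁻¹(Y)`. -/
def Fdomain (D : Set ℝ) (f : ℝ → ℝ) : Set (BackwardOrbit D f) := {y | y.1 0 ∈ D}

open Classical in
/-- The map `F : F⁻¹(Y) → Y`, `(y₀, y₁, …) ↦ (f(y₀), y₀, y₁, …)`, inverse to `F⁻¹ : Y → F⁻¹(Y)`
(extended by the identity outside `F⁻¹(Y)`, which is irrelevant). -/
noncomputable def F (y : BackwardOrbit D f) : BackwardOrbit D f :=
  if h : y.1 0 ∈ D then
    ⟨fun i => Nat.casesOn i (f (y.1 0)) y.1, fun i => by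
      cases i with
      | zero => exact ⟨h, rfl⟩
      | succ i => exact y.2 i⟩
  else y

/-- `F` inverts `F⁻¹` on `Y`. -/
theorem F_Finv (y : BackwardOrbit D f) : F (Finv y) = y := by
  have h : (Finv y).1 0 ∈ D := (y.2 0).1
  rw [F, dif_pos h]
  apply Subtype.ext
  funext i
  cases i with
  | zero => exact (y.2 0).2
  | succ i => rfl

/-- `F⁻¹` inverts `F` on the domain of `F`. -/
theorem Finv_F {y : BackwardOrbit D f} (h : y ∈ Fdomain D f) : Finv (F y) = y := by
  rw [F, dif_pos (show y.1 0 ∈ D from h)]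
  rfl

end BackwardOrbit

/-- `μbar` is the measure of the natural extension `(Y, F, μbar)` of `(f, μ)`: the `F`-invariant
measure on `Y` with `Π_* μbar = μ`. -/
structure IsNaturalExtension (D : Set ℝ) (f : ℝ → ℝ) (μ : Measure ℝ)
    (μbar : Measure (BackwardOrbit D f)) : Prop where
  invariant : IsInvariantOn (BackwardOrbit.Fdomain D f) BackwardOrbit.F μbar
  map_proj : μbar.map BackwardOrbit.proj = μ

open ProbabilityTheory in
/-- For a measure-preserving `g` there is a law on `ℝ^ℕ` whose marginal on the coordinates
`0, …, n` is the law of `(gⁿ x, …, g x, x)`, for every `n`. -/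
theorem exists_backward_law {μ : Measure ℝ} [IsProbabilityMeasure μ] {g : ℝ → ℝ}
    (hg : MeasurePreserving g μ μ) :
    ∃ P : Measure (ℕ → ℝ), IsProbabilityMeasure P ∧
      ∀ n : ℕ, P.map (Preorder.frestrictLe (π := fun _ => ℝ) n) =
        μ.map (fun x (i : Finset.Iic n) => g^[n - i] x) := by
  let k : Kernel ℝ ℝ := condDistrib id g μ
  have hk : μ ⊗ₘ k = μ.map (fun x => (g x, x)) := by
    have : μ.map g ⊗ₘ k = μ.map (fun x => (g x, x)) :=
      compProd_map_condDistrib (X := g) (Y := id) (μ := μ) aemeasurable_id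
    rwa [hg.map_eq] at this
  let κ (n : ℕ) : Kernel ((i : Finset.Iic n) → ℝ) ℝ :=
    k.comap (fun x => x ⟨n, Finset.mem_Iic.2 le_rfl⟩) (by fun_prop)
  have hκ (n) : IsMarkovKernel (κ n) := by dsimp only [κ]; infer_instance
  have hφ (n : ℕ) : Measurable (fun (x : ℝ) (i : Finset.Iic n) => g^[n - i] x) :=
    measurable_pi_lambda _ fun i => hg.measurable.iterate _
  let ν : Measure ((i : Finset.Iic 0) → ℝ) := μ.map (fun x (i : Finset.Iic 0) => g^[0 - i] x)
  have hν : IsProbabilityMeasure ν := Measure.isProbabilityMeasure_map (hφ 0).aemeasurable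
  have key (n : ℕ) : Kernel.partialTraj (X := fun _ => ℝ) κ 0 n ∘ₘ ν =
      μ.map (fun x (i : Finset.Iic n) => g^[n - i] x) := by
    induction n with
    | zero => simp [ν]
    | succ n ih =>
      have hpm := (MeasurableEquiv.piSingleton (X := fun _ => ℝ) n).measurable
      have hm := Kernel.IsMarkovKernel.map (κ n) hpm
      rw [Kernel.partialTraj_succ_of_le (Nat.zero_le n), ← Measure.map_comp ν _ (measurable_IicProdIoc (X := fun _ => ℝ)),
        ← Measure.comp_assoc, ih, ← Measure.compProd_eq_comp_prod]
      let G (z : ℝ × ℝ) : (i : Finset.Iic (n + 1)) → ℝ :=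
        IicProdIoc (X := fun _ => ℝ) n (n + 1)
          (fun i => g^[n - i] z.1, MeasurableEquiv.piSingleton (X := fun _ => ℝ) n z.2)
      have hG : Measurable G :=
        measurable_IicProdIoc.comp (((hφ n).comp measurable_fst).prodMk (hpm.comp measurable_snd))
      have hGx : (fun x (i : Finset.Iic (n + 1)) => g^[n + 1 - i] x) =
          G ∘ fun x => (g x, x) := by
        funext x i
        by_cases h : i.1 ≤ n
        · simp only [G, IicProdIoc_def, Function.comp, h, dif_pos]
          rw [show n + 1 - (i : ℕ) = (n - i) + 1 by omega, Function.iterate_succ_apply]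
        · have hi : i.1 = n + 1 := by have := Finset.mem_Iic.1 i.2; omega
          simp [G, IicProdIoc_def, hi, MeasurableEquiv.piSingleton]
      have hgx : Measurable (fun x => (g x, x)) := hg.measurable.prodMk measurable_id
      rw [hGx, ← Measure.map_map hG hgx, ← hk]
      ext S hS
      have hS' := measurable_IicProdIoc (X := fun _ => ℝ) (m := n) (n := n + 1) hS
      rw [Measure.map_apply (measurable_IicProdIoc (X := fun _ => ℝ)) hS, Measure.map_apply hG hS,
        Measure.compProd_apply hS', Measure.compProd_apply (hG hS),
        lintegral_map (Kernel.measurable_kernel_prodMk_left hS') (hφ n)]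
      refine lintegral_congr fun x => ?_
      rw [Kernel.map_apply' _ hpm _ (measurable_prodMk_left hS'), Kernel.comap_apply]
      simp only [Nat.sub_self, Function.iterate_zero, id]
      rfl
  refine ⟨Kernel.traj (X := fun _ => ℝ) κ 0 ∘ₘ ν, inferInstance, fun n => ?_⟩
  rw [Measure.map_comp _ _ (by fun_prop), Kernel.traj_map_frestrictLe, key]

/-- Finite measures on `ℝ^ℕ` with the same marginals on initial segments are equal. -/
theorem measure_ext_of_frestrictLe {P Q : Measure (ℕ → ℝ)} [IsFiniteMeasure P]
    (h : ∀ n : ℕ, P.map (Preorder.frestrictLe (π := fun _ => ℝ) n) =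
      Q.map (Preorder.frestrictLe (π := fun _ => ℝ) n)) : P = Q := by
  refine IsProjectiveLimit.unique (P := fun I : Finset ℕ => P.map I.restrict)
    (fun I => rfl) (fun I => ?_)
  have e : (I.restrict : (ℕ → ℝ) → (I → ℝ)) =
      Finset.restrict₂ (π := fun _ => ℝ) I.subset_Iic_sup_id ∘ Preorder.frestrictLe (π := fun _ => ℝ) (I.sup id) := by
    funext y i; rfl
  have m : Measurable (Finset.restrict₂ (π := fun _ => ℝ) I.subset_Iic_sup_id) :=
    Finset.measurable_restrict₂ _
  change Q.map I.restrict = P.map I.restrict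
  rw [e, ← Measure.map_map m (by fun_prop), ← Measure.map_map m (by fun_prop), h]

namespace BackwardOrbit

variable {D : Set ℝ} {f : ℝ → ℝ}

theorem measurable_proj : Measurable (proj : BackwardOrbit D f → ℝ) :=
  (measurable_pi_apply 0).comp measurable_subtype_coe

theorem measurable_Finv : Measurable (Finv : BackwardOrbit D f → BackwardOrbit D f) :=
  have h : Measurable (fun y : BackwardOrbit D f => fun i => y.1 (i + 1)) :=
    measurable_pi_lambda _ fun i => (measurable_pi_apply (i + 1)).comp measurable_subtype_coe
  h.subtype_mk

theorem Finv_iterate_apply (n i : ℕ) (y : BackwardOrbit D f) : (Finv^[n] y).1 i = y.1 (i + n) := by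
  induction n generalizing y with
  | zero => rfl
  | succ n ih =>
    rw [Function.iterate_succ_apply, ih]
    exact congrArg y.1 (by omega)

theorem measurableSet_Fdomain (hD : MeasurableSet D) : MeasurableSet (Fdomain D f) :=
  measurable_proj hD

theorem measurable_F (hD : MeasurableSet D) {g : ℝ → ℝ} (hg : Measurable g) (hgf : EqOn g f D) :
    Measurable (F : BackwardOrbit D f → BackwardOrbit D f) := by
  have hS := measurableSet_Fdomain (f := f) hD
  have h1 : Measurable (fun y : BackwardOrbit D f => (F y).1) := by
    refine measurable_pi_lambda _ fun i => ?_
    have e : (fun y : BackwardOrbit D f => (F y).1 i) = fun y =>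
        open Classical in
        if y ∈ Fdomain D f then (Nat.casesOn i (g (y.1 0)) y.1 : ℝ) else y.1 i := by
      funext y
      by_cases h : y.1 0 ∈ D
      · rw [F, dif_pos h, if_pos (show y ∈ Fdomain D f from h), hgf h]
      · rw [F, dif_neg h, if_neg (show y ∉ Fdomain D f from h)]
    rw [e]
    refine Measurable.ite hS ?_ ((measurable_pi_apply i).comp measurable_subtype_coe)
    cases i with
    | zero => exact hg.comp measurable_proj
    | succ i => exact (measurable_pi_apply i).comp measurable_subtype_coe
  exact h1.subtype_mk

/-- Invariance under `F` amounts to invariance under `F⁻¹`. -/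
theorem isInvariantOn_F_iff (hD : MeasurableSet D) {g : ℝ → ℝ} (hg : Measurable g)
    (hgf : EqOn g f D) {m : Measure (BackwardOrbit D f)} [IsFiniteMeasure m] :
    IsInvariantOn (Fdomain D f) F m ↔ MeasurePreserving Finv m m := by
  constructor
  · intro h
    refine ⟨measurable_Finv, Measure.ext fun B hB => ?_⟩
    rw [Measure.map_apply measurable_Finv hB, ← h _ (measurable_Finv hB)]
    have e : Fdomain D f ∩ F ⁻¹' (Finv ⁻¹' B) = Fdomain D f ∩ B := by
      ext y
      simp only [mem_inter_iff, mem_preimage]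
      exact and_congr_right fun hy => by rw [Finv_F hy]
    have hu : m (Fdomain D f)ᶜ = 0 := by
      have := h univ MeasurableSet.univ
      rw [preimage_univ, inter_univ] at this
      rw [measure_compl (measurableSet_Fdomain hD) (measure_ne_top _ _), this, tsub_self]
    rw [e, inter_comm, measure_inter_conull hu]
  · intro h A hA
    have e : Finv ⁻¹' (Fdomain D f ∩ F ⁻¹' A) = A := by
      ext y
      simp only [mem_inter_iff, mem_preimage, F_Finv]
      exact and_iff_right (y.2 0).1
    rw [← h.measure_preimage
      ((measurableSet_Fdomain hD).inter (measurable_F hD hg hgf hA)).nullMeasurableSet, e]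

/-- The finite-dimensional marginals of the natural extension. -/
theorem map_frestrictLe {g : ℝ → ℝ} (hg : Measurable g) (hgf : EqOn g f D) {μ : Measure ℝ}
    {m : Measure (BackwardOrbit D f)} (hm : MeasurePreserving Finv m m) (hμ : m.map proj = μ)
    (n : ℕ) :
    (m.map Subtype.val).map (Preorder.frestrictLe (π := fun _ => ℝ) n) =
      μ.map (fun x (i : Finset.Iic n) => g^[n - i] x) := by
  have hφ : Measurable (fun (x : ℝ) (i : Finset.Iic n) => g^[n - i] x) :=
    measurable_pi_lambda _ fun i => hg.iterate _
  have hn := hm.iterate n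
  rw [← hμ, ← hn.map_eq, Measure.map_map measurable_proj hn.measurable,
    Measure.map_map hφ (measurable_proj.comp hn.measurable), hn.map_eq,
    Measure.map_map (by fun_prop) measurable_subtype_coe]
  congr 1
  funext y i
  have key : ∀ j i : ℕ, g^[j] (y.1 (i + j)) = y.1 i := by
    intro j
    induction j with
    | zero => intro i; rfl
    | succ j ih =>
      intro i
      rw [Function.iterate_succ_apply, ← Nat.add_assoc, hgf (y.2 _).1, (y.2 _).2, ih]
  have hi := Finset.mem_Iic.1 i.2
  have := key (n - i) i
  rw [Nat.add_sub_cancel' hi] at this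
  simp only [Function.comp, Preorder.frestrictLe_apply, proj, Finv_iterate_apply, Nat.zero_add]
  exact this.symm

end BackwardOrbit

open BackwardOrbit in
/-- The natural extension of an invariant probability measure exists and is unique. -/
theorem existsUnique_isNaturalExtension {D : Set ℝ} {f : ℝ → ℝ} {μ : Measure ℝ}
    (hD : MeasurableSet D) (hf : ContinuousOn f D) (hprob : IsProbabilityMeasure μ)
    (hinv : IsInvariantOn D f μ) : ∃! μbar, IsNaturalExtension D f μ μbar := by
  classical
  have hDc : ∀ᵐ x ∂μ, x ∈ D := by
    have := hinv univ MeasurableSet.univ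
    rw [preimage_univ, inter_univ] at this
    rw [ae_iff, ← compl_def, measure_compl hD (measure_ne_top _ _), this, tsub_self]
  obtain ⟨g, hg, hgf⟩ : ∃ g : ℝ → ℝ, Measurable g ∧ EqOn g f D :=
    ⟨D.piecewise f 0, hf.measurable_piecewise continuousOn_const hD, piecewise_eqOn _ _ _⟩
  have hgμ : MeasurePreserving g μ μ := by
    refine ⟨hg, Measure.ext fun A hA => ?_⟩
    rw [Measure.map_apply hg hA, ← hinv A hA, ← measure_inter_conull (t := D) hDc]
    congr 1
    ext x
    simp only [mem_inter_iff, mem_preimage, and_comm]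
    exact and_congr_right fun hx => by rw [hgf hx]
  have hφ (n : ℕ) : Measurable (fun (x : ℝ) (i : Finset.Iic n) => g^[n - i] x) :=
    measurable_pi_lambda _ fun i => hg.iterate _
  obtain ⟨P, hP, hPn⟩ := exists_backward_law hgμ
  have hS : MeasurableSet {y : ℕ → ℝ | ∀ i, y (i + 1) ∈ D ∧ f (y (i + 1)) = y i} := by
    have : {y : ℕ → ℝ | ∀ i, y (i + 1) ∈ D ∧ f (y (i + 1)) = y i} =
        ⋂ i, {y : ℕ → ℝ | y (i + 1) ∈ D} ∩ {y | g (y (i + 1)) = y i} := by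
      ext y
      simp only [mem_iInter, mem_inter_iff, mem_ofPred_eq]
      exact forall_congr' fun i => and_congr_right fun h => by rw [hgf h]
    rw [this]
    exact MeasurableSet.iInter fun i => (measurable_pi_apply (i + 1) hD).inter
      (measurableSet_eq_fun (hg.comp (measurable_pi_apply _)) (measurable_pi_apply _))
  have hPS : ∀ᵐ y ∂P, ∀ i, y (i + 1) ∈ D ∧ f (y (i + 1)) = y i := by
    rw [ae_all_iff]
    intro i
    let T : Set ((j : Finset.Iic (i + 1)) → ℝ) :=
      {z | z ⟨i + 1, by simp⟩ ∈ D ∧ g (z ⟨i + 1, by simp⟩) = z ⟨i, by simp⟩}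
    have hp (j : Finset.Iic (i + 1)) :
        Measurable (fun z : (j : Finset.Iic (i + 1)) → ℝ => z j) := measurable_pi_apply j
    have hT : MeasurableSet T :=
      (hp _ hD).inter (measurableSet_eq_fun (hg.comp (hp _)) (hp _))
    have h1 : ∀ᵐ z ∂(P.map (Preorder.frestrictLe (π := fun _ => ℝ) (i + 1))), z ∈ T := by
      rw [hPn]
      refine (ae_map_iff (hφ _).aemeasurable hT).2 ?_
      filter_upwards [hDc] with x hx
      simp [hx]
    have h2 := ae_of_ae_map (by fun_prop) h1
    filter_upwards [h2] with y hy
    exact ⟨hy.1, (hgf hy.1).symm.trans hy.2⟩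
  have hemb : MeasurableEmbedding (Subtype.val : BackwardOrbit D f → (ℕ → ℝ)) :=
    MeasurableEmbedding.subtype_coe hS
  let m : Measure (BackwardOrbit D f) := P.comap Subtype.val
  have hm : m.map Subtype.val = P := by
    rw [hemb.map_comap, Subtype.range_coe_subtype]
    exact Measure.restrict_eq_self_of_ae_mem hPS
  have hmp : IsProbabilityMeasure m :=
    ⟨by rw [← preimage_univ (f := Subtype.val), ← hemb.map_apply, hm, measure_univ]⟩
  have hshift : MeasurePreserving Finv m m := by
    refine ⟨measurable_Finv, ?_⟩
    have hinj : Function.Injective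
        (fun ν : Measure (BackwardOrbit D f) => ν.map Subtype.val) := by
      intro ν₁ ν₂ h
      have := congrArg (Measure.comap (Subtype.val : BackwardOrbit D f → (ℕ → ℝ))) h
      simpa [hemb.comap_map] using this
    apply hinj
    let sh : (ℕ → ℝ) → (ℕ → ℝ) := fun y i => y (i + 1)
    have hsh : Measurable sh := measurable_pi_lambda _ fun i => measurable_pi_apply _
    change (m.map Finv).map Subtype.val = m.map Subtype.val
    rw [Measure.map_map measurable_subtype_coe measurable_Finv]
    change m.map (sh ∘ Subtype.val) = _
    rw [← Measure.map_map hsh measurable_subtype_coe, hm]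
    have : IsProbabilityMeasure (P.map sh) := Measure.isProbabilityMeasure_map hsh.aemeasurable
    refine measure_ext_of_frestrictLe fun n => ?_
    let tl : ((i : Finset.Iic (n + 1)) → ℝ) → ((i : Finset.Iic n) → ℝ) :=
      fun z i => z ⟨i + 1, by simpa using Finset.mem_Iic.1 i.2⟩
    have htl : Measurable tl := measurable_pi_lambda _ fun i => measurable_pi_apply _
    rw [Measure.map_map (by fun_prop) hsh, hPn n]
    change P.map (tl ∘ Preorder.frestrictLe (π := fun _ => ℝ) (n + 1)) = _
    rw [← Measure.map_map htl (by fun_prop), hPn, Measure.map_map htl (hφ _)]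
    congr 1
    funext x i
    simp [tl]
  refine ⟨m, ⟨(isInvariantOn_F_iff hD hg hgf).2 hshift, ?_⟩, ?_⟩
  · have h0 := hPn 0
    have he : Measurable (fun z : (i : Finset.Iic 0) → ℝ => z ⟨0, by simp⟩) :=
      measurable_pi_apply _
    have := congrArg (Measure.map (fun z : (i : Finset.Iic 0) → ℝ => z ⟨0, by simp⟩)) h0
    rw [← hm, Measure.map_map (by fun_prop) measurable_subtype_coe,
      Measure.map_map he (by fun_prop), Measure.map_map he (hφ 0)] at this
    refine Eq.trans this ?_
    exact Measure.map_id
  · intro m' hm'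
    have : IsProbabilityMeasure m' := by
      constructor
      have := congrArg (fun ν : Measure ℝ => ν univ) hm'.map_proj
      simpa [Measure.map_apply measurable_proj MeasurableSet.univ] using this
    have h' := (isInvariantOn_F_iff hD hg hgf).1 hm'.invariant
    have e : m'.map Subtype.val = P := by
      have : IsProbabilityMeasure (m'.map (Subtype.val : BackwardOrbit D f → (ℕ → ℝ))) :=
        Measure.isProbabilityMeasure_map measurable_subtype_coe.aemeasurable
      refine measure_ext_of_frestrictLe fun n => ?_
      rw [map_frestrictLe hg hgf h' hm'.map_proj, hPn]
    rw [← hemb.comap_map m', e]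

/-! Write `L n = log |Dfⁿ(yₙ)|`, the sum of `log |Df(yᵢ)|` over `1 ≤ i ≤ n`. The pointwise ergodic
theorem for `F⁻¹` gives `L n / n → χ` for almost every `y` (`ae_tendsto_backward_average`).
Ergodicity of the natural extension is not needed: an invariant set of `Y` projects to a multiple of
`μ`, so a function of `y₀` has the same mean over every invariant set.

The geometric input concerns one branch. If `C r^ε exp |log |Df(x)||` is at most `1/4`, then on the
ball of radius `r` about `x` the function `log |Df|` varies by at most twice that quantity
(`deriv_ratio`). The ball lies inside the branch, since at an endpoint of the branch `Df` tends to
`0` or `±∞` (`ball_subset`).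

The pullback of a ball of radius `s` along `y` has size about `s exp (-L n)`, so pulling back once
more costs distortion at most a constant times `s^ε exp (-ε L (n+1) + |L (n+1) - L n|)`. As `L n / n
→ χ > 0`, the increments are `o(n)` and these bounds are summable (`summable_distortionBound`). A
small `s = α(y)` makes their sum at most `1/2 < log 2`. Bounded distortion then keeps the pullbacks
small enough for the next step, and the induction closes (`branchPullback_spec`). The set `V`
consists of the backward orbits that stay in the successive pullbacks. -/

/-- The maximum `max (0, h, h + h ∘ T, …)` of the first `n + 1` Birkhoff sums. -/
noncomputable def birkhoffMax {X : Type*} (T : X → X) (h : X → ℝ) : ℕ → X → ℝ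
  | 0 => fun _ => 0
  | n + 1 => fun x => max 0 (h x + birkhoffMax T h n (T x))

/-! ### Maximal and pointwise ergodic theorems -/

section BirkhoffMax

variable {X : Type*} {T : X → X} {h : X → ℝ}

theorem birkhoffMax_succ (n : ℕ) (x : X) :
    birkhoffMax T h (n + 1) x = max 0 (h x + birkhoffMax T h n (T x)) := rfl

theorem birkhoffMax_nonneg (n : ℕ) (x : X) : 0 ≤ birkhoffMax T h n x := by
  cases n with
  | zero => exact le_rfl
  | succ n => exact le_max_left _ _

theorem birkhoffSum_le_birkhoffMax (n : ℕ) (x : X) : birkhoffSum T h n x ≤ birkhoffMax T h n x := by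
  induction n generalizing x with
  | zero => simp [birkhoffMax]
  | succ n ih =>
    rw [birkhoffSum_succ', birkhoffMax_succ]
    exact le_max_of_le_right (by linarith [ih (T x)])

theorem monotone_birkhoffMax (x : X) : Monotone fun n => birkhoffMax T h n x := by
  refine monotone_nat_of_le_succ fun n => ?_
  induction n generalizing x with
  | zero => exact birkhoffMax_nonneg 1 x
  | succ n ih =>
    exact max_le_max le_rfl (add_le_add le_rfl (ih (T x)))

/-- The left side has nonnegative integral by invariance and monotonicity in `n`; the right side
decreases to `h` where the maxima are unbounded. The maximal ergodic theorem follows by comparing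
the two. -/
theorem birkhoffMax_succ_sub (n : ℕ) (x : X) :
    birkhoffMax T h (n + 1) x - birkhoffMax T h n (T x) = max (-birkhoffMax T h n (T x)) (h x) := by
  rw [birkhoffMax_succ, max_sub_sub_right 0 _ _ |>.symm]
  simp

/-- Makes the set of unboundedness strictly invariant, not only up to a null set. -/
theorem bddAbove_birkhoffMax_comp_iff (x : X) :
    BddAbove (range fun n => birkhoffMax T h n (T x)) ↔
      BddAbove (range fun n => birkhoffMax T h n x) := by
  simp only [bddAbove_def, forall_mem_range]
  constructor
  · rintro ⟨K, hK⟩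
    refine ⟨max 0 (h x + K), fun n => ?_⟩
    cases n with
    | zero => exact le_max_left _ _
    | succ n => exact max_le_max le_rfl (by linarith [hK n])
  · rintro ⟨K, hK⟩
    refine ⟨K - h x, fun n => ?_⟩
    have h1 := (le_max_right _ _).trans_eq (birkhoffMax_succ (T := T) (h := h) n x).symm
    linarith [hK (n + 1)]

variable [MeasurableSpace X]

theorem measurable_birkhoffMax (hT : Measurable T) (hh : Measurable h) (n : ℕ) :
    Measurable (birkhoffMax T h n) := by
  induction n with
  | zero => exact measurable_const
  | succ n ih => exact measurable_const.max (hh.add (ih.comp hT))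

variable {P : Measure X}

theorem integrable_birkhoffMax (hT : MeasurePreserving T P P) (hi : Integrable h P) (n : ℕ) :
    Integrable (birkhoffMax T h n) P := by
  induction n with
  | zero => exact integrable_zero _ _ _
  | succ n ih =>
    exact (integrable_zero _ _ _).sup (hi.add (hT.integrable_comp_of_integrable ih))

/-- Maximal ergodic theorem: the integral is nonnegative over the set where the Birkhoff sums are
unbounded. -/
theorem setIntegral_nonneg_of_birkhoffMax_unbounded (hT : MeasurePreserving T P P)
    (hh : Measurable h) (hi : Integrable h P) {A : Set X} (hA : MeasurableSet A)
    (hTA : T ⁻¹' A = A) (hAu : ∀ x ∈ A, ¬ BddAbove (range fun n => birkhoffMax T h n x)) :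
    0 ≤ ∫ x in A, h x ∂P := by
  have hTr : MeasurePreserving T (P.restrict A) (P.restrict A) := by
    have := hT.restrict_preimage hA
    rwa [hTA] at this
  have hMi (n : ℕ) : Integrable (birkhoffMax T h n) (P.restrict A) :=
    integrable_birkhoffMax hTr hi.restrict n
  have hMTi (n : ℕ) : Integrable (fun x => birkhoffMax T h n (T x)) (P.restrict A) :=
    hTr.integrable_comp_of_integrable (hMi n)
  have lim : Tendsto (fun n => ∫ x in A, max (-birkhoffMax T h n (T x)) (h x) ∂P) atTop
      (𝓝 (∫ x in A, h x ∂P)) := by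
    refine integral_tendsto_of_tendsto_of_antitone (fun n => (hMTi n).neg.sup hi.restrict)
      hi.restrict (ae_of_all _ fun x m n hmn => ?_) ?_
    · exact max_le_max (neg_le_neg (monotone_birkhoffMax _ hmn)) le_rfl
    · filter_upwards [ae_restrict_mem hA] with x hx
      have hTx : T x ∈ A := by rwa [← mem_preimage, hTA]
      have := tendsto_atTop_of_monotone (monotone_birkhoffMax (T := T) (h := h) (T x))
      rcases this with h1 | ⟨l, hl⟩
      · refine tendsto_const_nhds.congr' ?_
        filter_upwards [h1.eventually_ge_atTop (-h x)] with n hn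
        exact (max_eq_right (by linarith)).symm
      · exact absurd hl.bddAbove_range (hAu _ hTx)
  refine ge_of_tendsto' lim fun n => ?_
  -- By invariance `T` can be dropped, which leaves the integral of the increment from `n` to `n +
  -- 1`.
  have e : ∫ x in A, birkhoffMax T h n (T x) ∂P = ∫ x in A, birkhoffMax T h n x ∂P := by
    conv_rhs => rw [← hTr.map_eq]
    exact (integral_map hTr.measurable.aemeasurable
      (measurable_birkhoffMax hT.measurable hh n).aestronglyMeasurable).symm
  simp only [← birkhoffMax_succ_sub]
  rw [integral_sub (hMi _) (hMTi _), e, sub_nonneg]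
  exact integral_mono (hMi _) (hMi _) fun x => monotone_birkhoffMax x n.le_succ

/-- On the invariant set `A` of unboundedness the maximal ergodic theorem gives `0 ≤ -δ P(A)`, so
`A` is null. -/
theorem ae_bddAbove_birkhoffMax [IsFiniteMeasure P] (hT : MeasurePreserving T P P)
    (hh : Measurable h) (hi : Integrable h P) {δ : ℝ} (hδ : 0 < δ)
    (hinv : ∀ A, MeasurableSet A → T ⁻¹' A = A → ∫ x in A, h x ∂P = -δ * P.real A) :
    ∀ᵐ x ∂P, BddAbove (range fun n => birkhoffMax T h n x) := by
  let A : Set X := {x | ¬ BddAbove (range fun n => birkhoffMax T h n x)}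
  have hA : MeasurableSet A :=
    (measurableSet_bddAbove_range fun n => measurable_birkhoffMax hT.measurable hh n).compl
  have hTA : T ⁻¹' A = A := by
    ext x
    exact not_congr (bddAbove_birkhoffMax_comp_iff x)
  have h1 := setIntegral_nonneg_of_birkhoffMax_unbounded hT hh hi hA hTA fun x hx => hx
  rw [hinv A hA hTA] at h1
  have h2 : P.real A = 0 := le_antisymm (by nlinarith [measureReal_nonneg (μ := P) (s := A)])
    measureReal_nonneg
  rw [ae_iff]
  exact (measureReal_eq_zero_iff).1 h2

/-- The function `h - (c + δ/2)` has mean `-δ/2` over invariant sets, so its Birkhoff sums are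
bounded by some `K`. The averages of `h` are then at most `c + δ/2 + K/n`, and `n > 2K/δ` suffices.
-/
theorem ae_eventually_birkhoffSum_div_lt [IsFiniteMeasure P] (hT : MeasurePreserving T P P)
    (hh : Measurable h) (hi : Integrable h P) {c : ℝ}
    (hinv : ∀ A, MeasurableSet A → T ⁻¹' A = A → ∫ x in A, h x ∂P = c * P.real A)
    {δ : ℝ} (hδ : 0 < δ) :
    ∀ᵐ x ∂P, ∀ᶠ n : ℕ in atTop, birkhoffSum T h n x / n < c + δ := by
  have h1 := ae_bddAbove_birkhoffMax (h := fun x => h x - (c + δ / 2)) hT (hh.sub_const _)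
    (hi.sub (integrable_const _)) (half_pos hδ) fun A hA hTA => by
      rw [integral_sub hi.restrict (integrable_const _), hinv A hA hTA]
      simp
      ring
  filter_upwards [h1] with x ⟨K, hK⟩
  filter_upwards [eventually_gt_atTop 0,
    tendsto_natCast_atTop_atTop.eventually_gt_atTop (2 * K / δ)] with n hn hn'
  have h2 := (birkhoffSum_le_birkhoffMax n x).trans (hK ⟨n, rfl⟩)
  have h3 : birkhoffSum T (fun x => h x - (c + δ / 2)) n x =
      birkhoffSum T h n x - n * (c + δ / 2) := by
    simp [birkhoffSum, Finset.sum_sub_distrib, mul_add]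
  rw [h3] at h2
  rw [div_lt_iff₀ hδ] at hn'
  have : (0 : ℝ) < n := by exact_mod_cast hn
  rw [div_lt_iff₀ this]
  nlinarith

/-- The pointwise ergodic theorem, for functions that have the same mean over each invariant
set. -/
theorem ae_tendsto_birkhoffSum_div [IsFiniteMeasure P] (hT : MeasurePreserving T P P)
    (hh : Measurable h) (hi : Integrable h P) {c : ℝ}
    (hinv : ∀ A, MeasurableSet A → T ⁻¹' A = A → ∫ x in A, h x ∂P = c * P.real A) :
    ∀ᵐ x ∂P, Tendsto (fun n : ℕ => birkhoffSum T h n x / n) atTop (𝓝 c) := by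
  have h1 : ∀ᵐ x ∂P, ∀ k : ℕ, ∀ᶠ n : ℕ in atTop, birkhoffSum T h n x / n < c + 1 / (k + 1) :=
    ae_all_iff.2 fun k => ae_eventually_birkhoffSum_div_lt hT hh hi hinv (by positivity)
  have h2 : ∀ᵐ x ∂P, ∀ k : ℕ, ∀ᶠ n : ℕ in atTop,
      birkhoffSum T (fun x => -h x) n x / n < -c + 1 / (k + 1) :=
    ae_all_iff.2 fun k => ae_eventually_birkhoffSum_div_lt hT hh.neg hi.neg
      (fun A hA hTA => (integral_neg _).trans (by rw [hinv A hA hTA]; ring)) (by positivity)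
  filter_upwards [h1, h2] with x hx1 hx2
  rw [Metric.tendsto_nhds]
  intro e he
  obtain ⟨k, hk⟩ := exists_nat_one_div_lt he
  filter_upwards [hx1 k, hx2 k] with n h3 h4
  have : birkhoffSum T (fun x => -h x) n x = -birkhoffSum T h n x := by simp [birkhoffSum]
  rw [this, neg_div] at h4
  rw [Real.dist_eq, abs_lt]
  constructor <;> linarith

end BirkhoffMax

/-! ### Time averages along backward orbits -/

section NaturalExtension

variable {D : Set ℝ} {f : ℝ → ℝ} {μ : Measure ℝ}

theorem IsInvariantOn.ae_mem {X : Type*} [MeasurableSpace X] {D : Set X} {T : X → X} {μ : Measure X}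
    [IsFiniteMeasure μ] (h : IsInvariantOn D T μ) (hD : MeasurableSet D) : ∀ᵐ x ∂μ, x ∈ D := by
  have := h univ MeasurableSet.univ
  rw [preimage_univ, inter_univ] at this
  rw [ae_iff, ← compl_def, measure_compl hD (measure_ne_top _ _), this, tsub_self]

/-- A `g`-invariant set need not be invariant for the partial map. Intersecting it with the
full-measure set `E` of points whose `g`-orbit never leaves `D` repairs this. -/
theorem IsErgodicInvariant.ergodic_of_eqOn {X : Type*} [MeasurableSpace X] {D : Set X} {T g : X → X}
    {μ : Measure X} (h : IsErgodicInvariant D T μ) (hD : MeasurableSet D) (hg : Measurable g)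
    (hgT : EqOn g T D) : Ergodic g μ := by
  have := h.prob
  have hDc := h.invariant.ae_mem hD
  have hmp : MeasurePreserving g μ μ := by
    refine ⟨hg, Measure.ext fun A hA => ?_⟩
    rw [Measure.map_apply hg hA, ← h.invariant A hA, ← measure_inter_conull (t := D) hDc]
    congr 1
    ext x
    simp only [mem_inter_iff, mem_preimage, and_comm]
    exact and_congr_right fun hx => by rw [hgT hx]
  refine ⟨hmp, ⟨fun s hs hgs => ?_⟩⟩
  let E : Set X := ⋂ k : ℕ, g^[k] ⁻¹' D
  have hE : MeasurableSet E := MeasurableSet.iInter fun k => hg.iterate k hD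
  have hEc : ∀ᵐ x ∂μ, x ∈ E := by
    simp only [E, mem_iInter]
    exact ae_all_iff.2 fun k => (hmp.iterate k).quasiMeasurePreserving.ae hDc
  have hA : D ∩ T ⁻¹' (s ∩ E) = s ∩ E := by
    ext x
    simp only [E, mem_inter_iff, mem_preimage, mem_iInter]
    have hsx : g x ∈ s ↔ x ∈ s := by rw [← mem_preimage, hgs]
    constructor
    · rintro ⟨hx, h1, h2⟩
      rw [← hgT hx] at h1 h2
      refine ⟨hsx.1 h1, fun k => ?_⟩
      cases k with
      | zero => exact hx
      | succ k => exact h2 k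
    · rintro ⟨h1, h2⟩
      have hx : x ∈ D := h2 0
      rw [← hgT hx]
      exact ⟨hx, hsx.2 h1, fun k => h2 (k + 1)⟩
  have hsE : μ (s ∩ E) = μ s := measure_inter_conull hEc
  rw [eventuallyConst_set']
  rcases h.ergodic _ (hs.inter hE) hA with h0 | h1
  · exact Or.inl (ae_eq_empty.2 (hsE ▸ h0))
  · right
    rw [ae_eq_univ, prob_compl_eq_zero_iff hs, ← hsE, h1]

open BackwardOrbit in
/-- A function of the zeroth coordinate has the same mean over each invariant set of the natural
extension. -/
theorem setIntegral_proj_of_invariant {g : ℝ → ℝ} (hgD : EqOn g f D) (hg : Ergodic g μ)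
    [IsProbabilityMeasure μ] {m : Measure (BackwardOrbit D f)} (hm : MeasurePreserving Finv m m)
    (hmμ : m.map proj = μ) {φ : ℝ → ℝ} (hφ : Measurable φ) {A : Set (BackwardOrbit D f)}
    (hA : MeasurableSet A) (hinv : Finv ⁻¹' A = A) :
    ∫ y in A, φ y.proj ∂m = (∫ x, φ x ∂μ) * m.real A := by
  have : IsProbabilityMeasure m := by
    constructor
    rw [← preimage_univ (f := (proj : BackwardOrbit D f → ℝ)),
      ← Measure.map_apply measurable_proj MeasurableSet.univ, hmμ, measure_univ]
  let ν : Measure ℝ := (m.restrict A).map proj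
  have hνfin : IsFiniteMeasure ν := by dsimp only [ν]; infer_instance
  have hνμ : ν ≪ μ := by
    rw [← hmμ]
    exact (Measure.absolutelyContinuous_of_le Measure.restrict_le_self).map measurable_proj
  have hmA : MeasurePreserving Finv (m.restrict A) (m.restrict A) := by
    have := hm.restrict_preimage hA
    rwa [hinv] at this
  have hgF (y : BackwardOrbit D f) : g (proj (Finv y)) = proj y :=
    (hgD (y.2 0).1).trans (y.2 0).2
  have hνg : MeasurePreserving g ν ν := by
    refine ⟨hg.measurable, ?_⟩
    conv_lhs => simp only [ν]; rw [← hmA.map_eq]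
    rw [Measure.map_map measurable_proj measurable_Finv,
      Measure.map_map hg.measurable (measurable_proj.comp measurable_Finv)]
    congr 1
    funext y
    exact hgF y
  -- Ergodicity of `g` enters here: an invariant measure absolutely continuous with respect to `μ`
  -- is a multiple of `μ`. The factor is found by comparing total masses.
  obtain ⟨c, hc⟩ := hg.eq_smul_of_absolutelyContinuous hνg hνμ
  have hcA : c = m A := by
    have h1 := congrArg (fun κ : Measure ℝ => κ univ) hc
    simpa [ν, Measure.map_apply measurable_proj MeasurableSet.univ] using h1.symm
  have h2 : ∫ x, φ x ∂ν = ∫ y in A, φ y.proj ∂m :=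
    integral_map measurable_proj.aemeasurable hφ.aestronglyMeasurable
  rw [← h2, hc, integral_smul_measure, hcA, smul_eq_mul, mul_comm]
  rfl

open BackwardOrbit in
/-- Along almost every backward orbit the time averages converge to the mean. -/
theorem ae_tendsto_backward_average (hD : MeasurableSet D) {g : ℝ → ℝ} (hg : Measurable g)
    (hgD : EqOn g f D) (hμ : IsErgodicInvariant D f μ)
    {m : Measure (BackwardOrbit D f)} (hm : IsNaturalExtension D f μ m)
    {φ : ℝ → ℝ} (hφ : Measurable φ) (hφi : Integrable φ μ) :
    ∀ᵐ y ∂m, Tendsto (fun n : ℕ => (∑ i ∈ Finset.range n, φ (y.1 (i + 1))) / n) atTop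
      (𝓝 (∫ x, φ x ∂μ)) := by
  have := hμ.prob
  have : IsProbabilityMeasure m := by
    constructor
    rw [← preimage_univ (f := (proj : BackwardOrbit D f → ℝ)),
      ← Measure.map_apply measurable_proj MeasurableSet.univ, hm.map_proj, measure_univ]
  have hF := (isInvariantOn_F_iff hD hg hgD).1 hm.invariant
  have hi : Integrable (fun y : BackwardOrbit D f => φ y.proj) m := by
    have := hm.map_proj
    rw [← this] at hφi
    exact hφi.comp_measurable measurable_proj
  have key := ae_tendsto_birkhoffSum_div hF (hφ.comp measurable_proj) hi
    fun A hA hTA => setIntegral_proj_of_invariant hgD (hμ.ergodic_of_eqOn hD hg hgD) hF hm.map_proj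
      hφ hA hTA
  -- Birkhoff sums at `y` start with `y₀`; those wanted start with `y₁`, hence the convergence is
  -- used at `Finv y`.
  filter_upwards [hF.quasiMeasurePreserving.ae key] with y hy
  refine hy.congr fun n => ?_
  congr 1
  refine Finset.sum_congr rfl fun i _ => ?_
  change φ ((Finv^[i] (Finv y)).1 0) = _
  rw [Finv_iterate_apply, Nat.zero_add]
  rfl

end NaturalExtension

/-! ### Diffeomorphisms between open sets of the line -/

theorem IsC1Diffeo.deriv_ne_zero {f : ℝ → ℝ} {U V : Set ℝ} (h : IsC1Diffeo f U V) {x : ℝ}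
    (hx : x ∈ U) : deriv f x ≠ 0 := by
  obtain ⟨hU, hV, hb, hf, g, hg, hgc⟩ := h
  have h1 : DifferentiableAt ℝ f x := (hf.differentiableOn one_ne_zero).differentiableAt (hU.mem_nhds hx)
  have h2 : DifferentiableAt ℝ g (f x) :=
    (hgc.differentiableOn one_ne_zero).differentiableAt (hV.mem_nhds (hb.mapsTo hx))
  have h3 : HasDerivAt (g ∘ f) (deriv g (f x) * deriv f x) x := h2.hasDerivAt.comp x h1.hasDerivAt
  have h4 : HasDerivAt (g ∘ f) 1 x := by
    refine (hasDerivAt_id x).congr_of_eventuallyEq ?_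
    filter_upwards [hU.mem_nhds hx] with z hz using hg.1 hz
  intro h0
  have := h3.unique h4
  simp [h0] at this

theorem IsC1Diffeo.differentiableAt {f : ℝ → ℝ} {U V : Set ℝ} (h : IsC1Diffeo f U V) {x : ℝ}
    (hx : x ∈ U) : DifferentiableAt ℝ f x :=
  (h.2.2.2.1.differentiableOn one_ne_zero).differentiableAt (h.1.mem_nhds hx)

theorem IsC1Diffeo.continuousOn_deriv {f : ℝ → ℝ} {U V : Set ℝ} (h : IsC1Diffeo f U V) :
    ContinuousOn (deriv f) U :=
  h.2.2.2.1.continuousOn_deriv_of_isOpen h.1 le_rfl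

theorem IsC1Diffeo.comp {f g : ℝ → ℝ} {U V W : Set ℝ} (hg : IsC1Diffeo g V W)
    (hf : IsC1Diffeo f U V) : IsC1Diffeo (g ∘ f) U W := by
  obtain ⟨hU, hV, hb, hfc, f', hf', hfc'⟩ := hf
  obtain ⟨-, hW, hb2, hgc, g', hg', hgc'⟩ := hg
  have hmg : MapsTo g' W V := hg'.1.mapsTo hb2.surjOn
  exact ⟨hU, hW, hb2.comp hb, hgc.comp hfc hb.mapsTo, f' ∘ g',
    ⟨hf'.1.comp hg'.1 hb.mapsTo, hf'.2.comp hg'.2 hmg⟩, hfc'.comp hgc' hmg⟩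

theorem IsC1Diffeo.restrict {f : ℝ → ℝ} {U V V' : Set ℝ} (hf : IsC1Diffeo f U V) (hV' : IsOpen V')
    (hVV : V' ⊆ V) : IsC1Diffeo f (U ∩ f ⁻¹' V') V' := by
  obtain ⟨hU, hV, hb, hfc, f', hf', hfc'⟩ := hf
  refine ⟨hfc.continuousOn.isOpen_inter_preimage hU hV', hV', ⟨fun x hx => hx.2,
    hb.injOn.mono inter_subset_left, fun w hw => ?_⟩, hfc.mono inter_subset_left, f',
    ⟨hf'.1.mono inter_subset_left, hf'.2.mono hVV⟩, hfc'.mono hVV⟩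
  obtain ⟨x, hx, rfl⟩ := hb.surjOn (hVV hw)
  exact ⟨x, ⟨hx, hw⟩, rfl⟩

theorem IsC1Diffeo.id {U : Set ℝ} (hU : IsOpen U) : IsC1Diffeo id U U :=
  ⟨hU, hU, bijOn_id _, contDiffOn_id, _root_.id, ⟨fun _ _ => rfl, fun _ _ => rfl⟩, contDiffOn_id⟩

/-- A `C¹` diffeomorphism onto a ball with expansion at least `K` is the inverse of a contraction. -/
theorem IsC1Diffeo.abs_sub_le_of_le_deriv {f : ℝ → ℝ} {U : Set ℝ} {c R K : ℝ}
    (h : IsC1Diffeo f U (Metric.ball c R)) (hK : 0 < K) (hd : ∀ x ∈ U, K ≤ |deriv f x|) {x x' : ℝ}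
    (hx : x ∈ U) (hx' : x' ∈ U) : |x' - x| ≤ K⁻¹ * |f x' - f x| := by
  obtain ⟨hU, hV, hb, hf, g, hg, hgc⟩ := _root_.id h
  have hgm : MapsTo g (Metric.ball c R) U := hg.1.mapsTo hb.surjOn
  have hgd (w) (hw : w ∈ Metric.ball c R) : HasDerivAt g (deriv f (g w))⁻¹ w := by
    have hgw : DifferentiableAt ℝ g w :=
      (hgc.differentiableOn one_ne_zero).differentiableAt (hV.mem_nhds hw)
    have h3 := (h.differentiableAt (hgm hw)).hasDerivAt.comp w hgw.hasDerivAt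
    have h4 : HasDerivAt (f ∘ g) 1 w := by
      refine (hasDerivAt_id w).congr_of_eventuallyEq ?_
      filter_upwards [hV.mem_nhds hw] with z hz using hg.2 hz
    rw [← eq_inv_of_mul_eq_one_right (h3.unique h4)]
    exact hgw.hasDerivAt
  -- The mean value inequality is applied to the inverse, whose domain is convex.
  have key := (convex_ball c R).norm_image_sub_le_of_norm_hasDerivWithin_le (C := K⁻¹)
    (fun w hw => (hgd w hw).hasDerivWithinAt)
    (fun w hw => by
      rw [norm_inv, Real.norm_eq_abs]
      exact inv_anti₀ hK (hd _ (hgm hw))) (hb.mapsTo hx) (hb.mapsTo hx')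
  rwa [hg.1 hx, hg.1 hx'] at key

/-! ### Distortion and covering for a single branch -/

/-- A function with the Hölder property where it is at most `2` keeps that property near a point
where it is at most `1`. -/
theorem abs_sub_le_of_holder_of_le_one {u : ℝ → ℝ} {s : Set ℝ} (hs : s.OrdConnected)
    (hu : ContinuousOn u s) {C ε r : ℝ} (hC : 0 < C) (hε : 0 < ε)
    (hH : ∀ x ∈ s, ∀ x' ∈ s, |u x| ≤ 2 → |u x'| ≤ 2 → |u x - u x'| ≤ C * |x - x'| ^ ε)
    {x x' : ℝ} (hx : x ∈ s) (hx' : x' ∈ s) (hx1 : |u x| ≤ 1) (hr : C * r ^ ε ≤ 1 / 4)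
    (hxr : |x' - x| ≤ r) : |u x' - u x| ≤ C * |x' - x| ^ ε := by
  refine hH _ hx' _ hx ?_ (by linarith)
  -- If `|u x'| > 2`, some intermediate `z` has `|u z| = 3/2`. The Hölder property applies to `z`
  -- and `x`, and its bound `1/4` contradicts `|u z| - |u x| ≥ 1/2`.
  by_contra! h2
  have hsub : uIcc x x' ⊆ s := hs.uIcc_subset hx hx'
  obtain ⟨z, hz, hz2⟩ : (3 / 2 : ℝ) ∈ (fun t => |u t|) '' uIcc x x' :=
    intermediate_value_uIcc ((hu.mono hsub).abs) 
      (mem_uIcc_of_le (show |u x| ≤ 3 / 2 by linarith) (show 3 / 2 ≤ |u x'| by linarith))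
  have hz2 : |u z| = 3 / 2 := hz2
  have h3 := hH z (hsub hz) x hx (by linarith) (by linarith)
  have h4 : |z - x| ≤ r := (abs_sub_left_of_mem_uIcc hz).trans hxr
  have h5 : C * |z - x| ^ ε ≤ C * r ^ ε :=
    mul_le_mul_of_nonneg_left (Real.rpow_le_rpow (abs_nonneg _) h4 hε.le) hC.le
  have h6 := abs_sub_abs_le_abs_sub (u z) (u x)
  linarith

theorem abs_log_le_two_mul {w t : ℝ} (ht : t ≤ 1 / 4) (hw : |w - 1| ≤ t) :
    |Real.log w| ≤ 2 * t := by
  obtain ⟨h1, h2⟩ := abs_le.1 hw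
  have hw0 : 0 < w := by linarith
  have ht0 : 0 ≤ t := (abs_nonneg _).trans hw
  have h3 := Real.log_le_sub_one_of_pos hw0
  have h4 := Real.one_sub_inv_le_log_of_pos hw0
  have h5 : w⁻¹ ≤ 1 + 2 * t := by
    rw [inv_le_iff_one_le_mul₀ hw0]
    nlinarith
  rw [abs_le]
  constructor <;> linarith

theorem not_limZeroOrInfinite {φ : ℝ → ℝ} {l : Filter ℝ} [l.NeBot] {c c' : ℝ} (hc : 0 < c)
    (h : ∀ᶠ x in l, c ≤ |φ x| ∧ |φ x| ≤ c') : ¬ LimZeroOrInfinite φ l := by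
  rintro (h0 | h1 | h1)
  · have := h0.abs
    rw [abs_zero] at this
    obtain ⟨x, hx, hx'⟩ := (h.and (this.eventually_lt_const hc)).exists
    linarith [hx.1]
  · obtain ⟨x, hx, hx'⟩ := (h.and (h1.eventually_gt_atTop c')).exists
    linarith [hx.2, le_abs_self (φ x)]
  · obtain ⟨x, hx, hx'⟩ := (h.and (h1.eventually_lt_atBot (-c'))).exists
    linarith [hx.2, neg_le_abs (φ x)]

namespace IsCuspMapWith

variable {ι : Type*} {a b : ℝ} {p q : ι → ℝ} {f : ℝ → ℝ} {C ε : ℝ} {j : ι} {x r : ℝ}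

theorem deriv_ne_zero (hf : IsCuspMapWith a b p q f C ε) (hx : x ∈ Ioo (p j) (q j)) :
    deriv f x ≠ 0 := (hf.basic.diffeo j).deriv_ne_zero hx

/-- The factor `exp |log |Df(x)||` is the larger of `|Df(x)|` and its inverse. It turns the Hölder
bound into a relative one: for `Df` when `|Df(x)| ≤ 1`, for `1 / Df` when `|Df(x)| ≥ 1`. -/
theorem deriv_ratio (hf : IsCuspMapWith a b p q f C ε) (hx : x ∈ Ioo (p j) (q j))
    (hr : C * r ^ ε * Real.exp |Real.log (|deriv f x|)| ≤ 1 / 4) {x' : ℝ}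
    (hx' : x' ∈ Ioo (p j) (q j)) (hxr : |x' - x| ≤ r) :
    (1 / 2 ≤ deriv f x' / deriv f x ∧ deriv f x' / deriv f x ≤ 2) ∧
      |(Real.log |deriv f x'|) - (Real.log |deriv f x|)| ≤
        2 * (C * |x' - x| ^ ε * Real.exp |Real.log (|deriv f x|)|) := by
  have hC := hf.C_pos
  have hε := hf.ε_pos
  have hd := hf.deriv_ne_zero hx
  have hd' := hf.deriv_ne_zero hx'
  have hr0 : 0 ≤ r := (abs_nonneg _).trans hxr
  have hexp : 1 ≤ Real.exp |Real.log (|deriv f x|)| := Real.one_le_exp (abs_nonneg _)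
  have hr1 : C * r ^ ε ≤ 1 / 4 :=
    (le_mul_of_one_le_right (mul_nonneg hC.le (Real.rpow_nonneg hr0 _)) hexp).trans hr
  have hcont := (hf.basic.diffeo j).continuousOn_deriv
  have hxr' : C * |x' - x| ^ ε * Real.exp |Real.log (|deriv f x|)| ≤ 1 / 4 :=
    (mul_le_mul_of_nonneg_right (mul_le_mul_of_nonneg_left
      (Real.rpow_le_rpow (abs_nonneg _) hxr hε.le) hC.le) (Real.exp_pos _).le).trans hr
  have hlog : Real.log |deriv f x'| - Real.log |deriv f x| =
      Real.log (deriv f x' / deriv f x) := by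
    rw [Real.log_abs, Real.log_abs, Real.log_div hd' hd]
  rw [hlog]
  rcases le_total |deriv f x| 1 with h1 | h1
  · have hE : Real.exp |Real.log (|deriv f x|)| = |deriv f x|⁻¹ := by
      rw [abs_of_nonpos (Real.log_nonpos (abs_nonneg _) h1), Real.exp_neg,
        Real.exp_log (abs_pos.2 hd)]
    rw [hE] at hxr' ⊢
    have h2 := abs_sub_le_of_holder_of_le_one ordConnected_Ioo hcont hC hε (hf.holder j) hx hx' h1
      hr1 hxr
    have h3 : |deriv f x' / deriv f x - 1| ≤ C * |x' - x| ^ ε * |deriv f x|⁻¹ := by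
      rw [div_sub_one hd, abs_div, div_eq_mul_inv]
      exact mul_le_mul_of_nonneg_right h2 (by positivity)
    refine ⟨?_, abs_log_le_two_mul hxr' h3⟩
    have := abs_le.1 (h3.trans hxr')
    constructor <;> linarith
  · have hE : Real.exp |Real.log (|deriv f x|)| = |deriv f x| := by
      rw [abs_of_nonneg (Real.log_nonneg h1), Real.exp_log (abs_pos.2 hd)]
    rw [hE] at hxr' ⊢
    have half {z : ℝ} (hz : z ∈ Ioo (p j) (q j)) (h : |1 / deriv f z| ≤ 2) :
        2⁻¹ ≤ |deriv f z| := by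
      rw [one_div, abs_inv] at h
      exact inv_le_of_inv_le₀ (abs_pos.2 (hf.deriv_ne_zero hz)) h
    have h2 := abs_sub_le_of_holder_of_le_one (u := fun z => 1 / deriv f z) ordConnected_Ioo
      (continuousOn_const.div hcont fun z hz => hf.deriv_ne_zero hz) hC hε
      (fun z hz z' hz' h h' => hf.holder_inv j z hz z' hz' (half hz h) (half hz' h')) hx hx'
      (by rw [one_div, abs_inv]; exact inv_le_one_of_one_le₀ h1) hr1 hxr
    have h3 : |deriv f x / deriv f x' - 1| ≤ C * |x' - x| ^ ε * |deriv f x| := by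
      have : deriv f x / deriv f x' - 1 = (1 / deriv f x' - 1 / deriv f x) * deriv f x := by
        field_simp
      rw [this, abs_mul]
      exact mul_le_mul_of_nonneg_right h2 (abs_nonneg _)
    have h4 : Real.log (deriv f x' / deriv f x) = -Real.log (deriv f x / deriv f x') := by
      rw [← Real.log_inv, inv_div]
    refine ⟨?_, by rw [h4, abs_neg]; exact abs_log_le_two_mul hxr' h3⟩
    have h5 := abs_le.1 (h3.trans hxr')
    have h6 : 0 < deriv f x / deriv f x' := by linarith
    rw [← inv_div (deriv f x)]
    constructor
    · rw [one_div]; exact inv_anti₀ h6 (by linarith)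
    · exact inv_le_of_inv_le₀ (by positivity) (by linarith)

/-- If an endpoint of the branch were inside the ball, `|Df|` would stay between `|Df(x)| / 2` and
`2 |Df(x)|` on approaching it, so it could tend neither to `0` nor to infinity. -/
theorem ball_subset (hf : IsCuspMapWith a b p q f C ε) (hx : x ∈ Ioo (p j) (q j))
    (hr : C * r ^ ε * Real.exp |Real.log (|deriv f x|)| ≤ 1 / 4) :
    Ioo (x - r) (x + r) ⊆ Ioo (p j) (q j) := by
  have hd : 0 < |deriv f x| := abs_pos.2 (hf.deriv_ne_zero hx)
  have key {z : ℝ} (hz : z ∈ Ioo (p j) (q j)) (hzr : |z - x| ≤ r) :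
      |deriv f x| / 2 ≤ |deriv f z| ∧ |deriv f z| ≤ 2 * |deriv f x| := by
    obtain ⟨⟨h1, h2⟩, -⟩ := hf.deriv_ratio hx hr hz hzr
    have h3 : |deriv f z| / |deriv f x| = deriv f z / deriv f x := by
      rw [← abs_div, abs_of_pos (by linarith)]
    rw [← h3] at h1 h2
    rw [le_div_iff₀ hd] at h1
    rw [div_le_iff₀ hd] at h2
    constructor <;> linarith
  refine Ioo_subset_Ioo ?_ ?_
  · by_contra! h
    refine not_limZeroOrInfinite (c' := 2 * |deriv f x|) (l := 𝓝[>] p j) (half_pos hd) ?_ (hf.basic.lim_left j)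
    filter_upwards [Ioo_mem_nhdsGT hx.1] with z hz
    exact key ⟨hz.1, hz.2.trans hx.2⟩ (by rw [abs_le]; constructor <;> linarith [hz.1, hz.2])
  · by_contra! h
    refine not_limZeroOrInfinite (c' := 2 * |deriv f x|) (l := 𝓝[<] q j) (half_pos hd) ?_ (hf.basic.lim_right j)
    filter_upwards [Ioo_mem_nhdsLT hx.2] with z hz
    exact key ⟨hx.1.trans hz.1, hz.2⟩ (by rw [abs_le]; constructor <;> linarith [hz.1, hz.2])

/-- Dividing `f` by `Df(x)` removes the sign and leaves a function with slope at least `1/2` on the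
ball; the intermediate value theorem then covers half the radius. -/
theorem ball_subset_image (hf : IsCuspMapWith a b p q f C ε) (hx : x ∈ Ioo (p j) (q j))
    (hr : C * r ^ ε * Real.exp |Real.log (|deriv f x|)| ≤ 1 / 4) :
    Metric.ball (f x) (|deriv f x| * (r / 2)) ⊆ f '' Ioo (x - r) (x + r) := by
  intro w hw
  have hd := hf.deriv_ne_zero hx
  have hd0 : 0 < |deriv f x| := abs_pos.2 hd
  rw [Metric.mem_ball, Real.dist_eq] at hw
  -- Room is left so that the closed interval of radius `2s` fits in the open ball.
  obtain ⟨s, hs1, hs2⟩ := exists_between ((div_lt_iff₀' hd0).2 hw)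
  have hs0 : 0 ≤ s := le_trans (by positivity) hs1.le
  have hsub : Icc (x - 2 * s) (x + 2 * s) ⊆ Ioo (x - r) (x + r) := fun z hz =>
    ⟨by linarith [hz.1], by linarith [hz.2]⟩
  have hIj := hsub.trans (hf.ball_subset hx hr)
  let h : ℝ → ℝ := fun z => f z / deriv f x
  have hdiff (z) (hz : z ∈ Icc (x - 2 * s) (x + 2 * s)) : DifferentiableAt ℝ f z :=
    (hf.basic.diffeo j).differentiableAt (hIj hz)
  have hc : ContinuousOn h (Icc (x - 2 * s) (x + 2 * s)) := fun z hz =>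
    ((hdiff z hz).div_const _).continuousAt.continuousWithinAt
  have hslope := (convex_Icc (x - 2 * s) (x + 2 * s)).mul_sub_le_image_sub_of_le_deriv hc
    (fun z hz => ((hdiff z (interior_subset hz)).div_const _).differentiableWithinAt)
    (C := 1 / 2) (fun z hz => by
      have hz := interior_subset hz
      simp only [h, deriv_div_const]
      have := hsub hz
      exact (hf.deriv_ratio hx hr (hIj hz)
        (by rw [abs_le]; constructor <;> linarith [this.1, this.2])).1.1)
  have mem {z : ℝ} (h1 : x - 2 * s ≤ z) (h2 : z ≤ x + 2 * s) : z ∈ Icc (x - 2 * s) (x + 2 * s) :=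
    ⟨h1, h2⟩
  have hR := hslope x (mem (by linarith) (by linarith)) (x + 2 * s) (mem (by linarith) le_rfl)
    (by linarith)
  have hL := hslope (x - 2 * s) (mem le_rfl (by linarith)) x (mem (by linarith) (by linarith))
    (by linarith)
  have hw' : |w / deriv f x - h x| < s := by
    simp only [h]
    rwa [← sub_div, abs_div]
  rw [abs_lt] at hw'
  obtain ⟨z, hz, hzw⟩ := intermediate_value_Icc (by linarith : x - 2 * s ≤ x + 2 * s) hc
    (show w / deriv f x ∈ _ from ⟨by linarith, by linarith⟩)
  exact ⟨z, hsub hz, (div_left_inj' hd).1 hzw⟩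

end IsCuspMapWith

/-! ### Pullbacks along a backward orbit -/

/-- The iterated pullback of `B` along the branches `f : (p (j n), q (j n)) → ℝ`. -/
def branchPullback {ι : Type*} (p q : ι → ℝ) (f : ℝ → ℝ) (j : ℕ → ι) (B : Set ℝ) : ℕ → Set ℝ
  | 0 => B
  | n + 1 => Ioo (p (j n)) (q (j n)) ∩ f ⁻¹' branchPullback p q f j B n

namespace BackwardOrbit

variable {D : Set ℝ} {f : ℝ → ℝ}

theorem iterate_apply (y : BackwardOrbit D f) (n : ℕ) : f^[n] (y.1 n) = y.1 0 := by
  induction n with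
  | zero => rfl
  | succ n ih => rw [Function.iterate_succ_apply, (y.2 n).2, ih]

theorem proj_Finv_iterate (y : BackwardOrbit D f) (n : ℕ) : (Finv^[n] y).proj = y.1 n := by
  rw [proj, Finv_iterate_apply, Nat.zero_add]

theorem hasDerivAt_iterate (hf : ∀ x ∈ D, DifferentiableAt ℝ f x) (y : BackwardOrbit D f) (n : ℕ) :
    HasDerivAt f^[n] (∏ i ∈ Finset.range n, deriv f (y.1 (i + 1))) (y.1 n) := by
  induction n with
  | zero => simpa using hasDerivAt_id _
  | succ n ih =>
    rw [Finset.prod_range_succ, Function.iterate_succ]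
    rw [← (y.2 n).2] at ih
    exact ih.comp _ (hf _ (y.2 n).1).hasDerivAt

/-- The backward orbits that stay in a sequence of sets which `f` maps bijectively to each other
project onto these sets. -/
theorem proj_image_Finv_iterate {W : ℕ → Set ℝ} (hb : ∀ n, BijOn f^[n] (W n) (W 0))
    (hW : ∀ n, W (n + 1) ⊆ D ∩ f ⁻¹' W n) (n : ℕ) :
    proj '' (Finv^[n] '' {y : BackwardOrbit D f | ∀ k, y.1 k ∈ W k}) = W n := by
  ext x
  constructor
  · rintro ⟨-, ⟨y, hy, rfl⟩, rfl⟩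
    rw [proj_Finv_iterate]
    exact hy n
  · intro hx
    have hw := (hb n).mapsTo hx
    -- The point `fⁿ x` has one preimage in each `W k`. Uniqueness makes these preimages a backward
    -- orbit, whose `n`-th entry is `x`.
    choose z hz hzw using fun k => (hb k).surjOn hw
    refine ⟨_, ⟨⟨z, fun k => ⟨(hW k (hz (k + 1))).1, ?_⟩⟩, hz, rfl⟩, ?_⟩
    · refine (hb k).injOn (hW k (hz (k + 1))).2 (hz k) ?_
      rw [hzw k, ← Function.iterate_succ_apply, hzw]
    · rw [proj_Finv_iterate]
      exact (hb n).injOn (hz n) hx (hzw n)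

end BackwardOrbit

namespace IsCuspMapWith

variable {ι : Type*} {a b : ℝ} {p q : ι → ℝ} {f : ℝ → ℝ} {C ε : ℝ}

theorem differentiableAt (hf : IsCuspMapWith a b p q f C ε) {x : ℝ} (hx : x ∈ cuspDomain p q) :
    DifferentiableAt ℝ f x := by
  obtain ⟨j, hj⟩ := mem_iUnion.1 hx
  exact (hf.basic.diffeo j).differentiableAt hj

theorem deriv_ne_zero_of_mem_cuspDomain (hf : IsCuspMapWith a b p q f C ε) {x : ℝ} (hx : x ∈ cuspDomain p q) :
    deriv f x ≠ 0 := by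
  obtain ⟨j, hj⟩ := mem_iUnion.1 hx
  exact hf.deriv_ne_zero hj

theorem abs_deriv_iterate (hf : IsCuspMapWith a b p q f C ε)
    (y : BackwardOrbit (cuspDomain p q) f) (n : ℕ) :
    |deriv f^[n] (y.1 n)| = ∏ i ∈ Finset.range n, |deriv f (y.1 (i + 1))| := by
  rw [(y.hasDerivAt_iterate (fun _ => hf.differentiableAt) n).deriv, Finset.abs_prod]

theorem abs_deriv_iterate_succ (hf : IsCuspMapWith a b p q f C ε)
    (y : BackwardOrbit (cuspDomain p q) f) (n : ℕ) :
    |deriv f^[n + 1] (y.1 (n + 1))| = |deriv f^[n] (y.1 n)| * |deriv f (y.1 (n + 1))| := by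
  rw [hf.abs_deriv_iterate, hf.abs_deriv_iterate, Finset.prod_range_succ]

theorem abs_deriv_iterate_pos (hf : IsCuspMapWith a b p q f C ε)
    (y : BackwardOrbit (cuspDomain p q) f) (n : ℕ) : 0 < |deriv f^[n] (y.1 n)| := by
  rw [hf.abs_deriv_iterate]
  exact Finset.prod_pos fun i _ => abs_pos.2 (hf.deriv_ne_zero_of_mem_cuspDomain (y.2 i).1)

/-- A bound for the distortion of `f` on the preimage of a neighbourhood of size `s` of the starting
point of a backward orbit. -/
noncomputable def distortionBound (f : ℝ → ℝ) (C ε : ℝ) {D : Set ℝ} (y : BackwardOrbit D f) (s : ℝ)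
    (n : ℕ) : ℝ :=
  2 * (C * (4 * s / |deriv f^[n + 1] (y.1 (n + 1))|) ^ ε *
    Real.exp |Real.log (|deriv f (y.1 (n + 1))|)|)

theorem distortionBound_nonneg (hf : IsCuspMapWith a b p q f C ε)
    (y : BackwardOrbit (cuspDomain p q) f) {s : ℝ} (hs : 0 ≤ s) (n : ℕ) :
    0 ≤ distortionBound f C ε y s n := by
  have := hf.C_pos
  unfold distortionBound
  positivity

/-- Convergence need only be known at scale `1`; shrinking `s` then makes the sum as small as
desired. -/
theorem distortionBound_eq_mul {D : Set ℝ} (y : BackwardOrbit D f) {s : ℝ} (hs : 0 ≤ s) (n : ℕ) :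
    distortionBound f C ε y s n = s ^ ε * distortionBound f C ε y 1 n := by
  have : 4 * s / |deriv f^[n + 1] (y.1 (n + 1))| = s * (4 * 1 / |deriv f^[n + 1] (y.1 (n + 1))|) := by
    ring
  rw [distortionBound, this, Real.mul_rpow hs (by positivity), distortionBound]
  ring

section Pullback

variable {y : BackwardOrbit (cuspDomain p q) f} {j : ℕ → ι} {s : ℝ}

/-- With `r = 4s / |Dfⁿ⁺¹(yₙ₊₁)|`, the ball covered by `ball_subset_image` has radius `|Df(yₙ₊₁)| r
/ 2 = 2s / |Dfⁿ(yₙ)|`, exactly the size allowed for `W`. -/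
theorem branch_step (hf : IsCuspMapWith a b p q f C ε)
    (hj : ∀ n, y.1 (n + 1) ∈ Ioo (p (j n)) (q (j n))) {n : ℕ}
    (hn : distortionBound f C ε y s n ≤ 1 / 2) {W : Set ℝ}
    (hW : ∀ x ∈ W, |x - y.1 n| < 2 * s / |deriv f^[n] (y.1 n)|) :
    W ⊆ f '' Ioo (p (j n)) (q (j n)) ∧ ∀ x ∈ Ioo (p (j n)) (q (j n)) ∩ f ⁻¹' W,
      |(Real.log |deriv f x|) - (Real.log |deriv f (y.1 (n + 1))|)| ≤
        distortionBound f C ε y s n := by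
  have hr : C * (4 * s / |deriv f^[n + 1] (y.1 (n + 1))|) ^ ε *
      Real.exp |Real.log (|deriv f (y.1 (n + 1))|)| ≤ 1 / 4 := by
    unfold distortionBound at hn
    linarith
  have hWf : W ⊆ f '' Ioo (y.1 (n + 1) - 4 * s / |deriv f^[n + 1] (y.1 (n + 1))|)
      (y.1 (n + 1) + 4 * s / |deriv f^[n + 1] (y.1 (n + 1))|) := by
    refine Subset.trans (fun x hx => ?_) (hf.ball_subset_image (hj n) hr)
    rw [Metric.mem_ball, Real.dist_eq, (y.2 n).2]
    refine (hW x hx).trans_eq ?_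
    have h1 := hf.abs_deriv_iterate_pos y n
    have h2 : 0 < |deriv f (y.1 (n + 1))| := abs_pos.2 (hf.deriv_ne_zero_of_mem_cuspDomain (y.2 n).1)
    rw [hf.abs_deriv_iterate_succ]
    field_simp
    ring
  have hsub := hf.ball_subset (hj n) hr
  refine ⟨hWf.trans (image_mono hsub), fun x hx => ?_⟩
  obtain ⟨z, hz, hzx⟩ := hWf hx.2
  -- Injectivity on the branch puts the whole pullback in the ball of radius `r`, where
  -- `deriv_ratio` applies.
  obtain rfl : z = x := (hf.basic.diffeo (j n)).2.2.1.injOn (hsub hz) hx.1 hzx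
  have hzr : |z - y.1 (n + 1)| ≤ 4 * s / |deriv f^[n + 1] (y.1 (n + 1))| := by
    rw [abs_le]
    constructor <;> linarith [hz.1, hz.2]
  refine (hf.deriv_ratio (hj n) hr hx.1 hzr).2.trans ?_
  have := hf.C_pos
  have := hf.ε_pos
  unfold distortionBound
  gcongr

/-- Since `1/2 < log 2`, the derivative of `fⁿ` on `W` is at least half its value at `yₙ`, so the
inverse branch contracts by `2 / |Dfⁿ(yₙ)|`. -/
theorem abs_sub_lt_of_distortion_le (hf : IsCuspMapWith a b p q f C ε) (hs : 0 < s) {n : ℕ}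
    {W : Set ℝ} (hW : IsC1Diffeo f^[n] W (Metric.ball y.proj s)) (hy : y.1 n ∈ W)
    (hd : ∀ x ∈ W, |(Real.log |deriv f^[n] x|) - (Real.log |deriv f^[n] (y.1 n)|)| ≤ 1 / 2) {x : ℝ}
    (hx : x ∈ W) : |x - y.1 n| < 2 * s / |deriv f^[n] (y.1 n)| := by
  have hD := hf.abs_deriv_iterate_pos y n
  have key : ∀ x ∈ W, |deriv f^[n] (y.1 n)| / 2 ≤ |deriv f^[n] x| := fun x hx => by
    rw [← Real.log_le_log_iff (by positivity) (abs_pos.2 (hW.deriv_ne_zero hx)),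
      Real.log_div hD.ne' two_ne_zero]
    linarith [(abs_le.1 (hd x hx)).1, Real.log_two_gt_d9]
  have h1 := hW.abs_sub_le_of_le_deriv (half_pos hD) key hy hx
  have h2 : |f^[n] x - f^[n] (y.1 n)| < s := by
    rw [y.iterate_apply]
    exact hW.2.2.1.mapsTo hx
  refine h1.trans_lt ((mul_lt_mul_of_pos_left h2 (by positivity)).trans_eq ?_)
  field_simp

/-- The properties support each other: the size bound at `n` permits the next branch step, which
extends the diffeomorphism and adds one distortion term. The total, still at most `1/2`, returns the
size bound at `n + 1`. -/
theorem branchPullback_spec (hf : IsCuspMapWith a b p q f C ε) (hs : 0 < s)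
    (hj : ∀ n, y.1 (n + 1) ∈ Ioo (p (j n)) (q (j n)))
    (hsum : ∀ n, ∑ i ∈ Finset.range n, distortionBound f C ε y s i ≤ 1 / 2) (n : ℕ) :
    IsC1Diffeo f^[n] (branchPullback p q f j (Metric.ball y.proj s) n) (Metric.ball y.proj s) ∧
      y.1 n ∈ branchPullback p q f j (Metric.ball y.proj s) n ∧
      (∀ x ∈ branchPullback p q f j (Metric.ball y.proj s) n,
        |(Real.log |deriv f^[n] x|) - (Real.log |deriv f^[n] (y.1 n)|)| ≤
          ∑ i ∈ Finset.range n, distortionBound f C ε y s i) ∧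
      ∀ x ∈ branchPullback p q f j (Metric.ball y.proj s) n,
        |x - y.1 n| < 2 * s / |deriv f^[n] (y.1 n)| := by
  induction n with
  | zero =>
    have h0 : IsC1Diffeo f^[0] (Metric.ball y.proj s) (Metric.ball y.proj s) :=
      IsC1Diffeo.id Metric.isOpen_ball
    have h1 : y.1 0 ∈ Metric.ball y.proj s := Metric.mem_ball_self hs
    have h2 (x : ℝ) : |(Real.log |deriv f^[0] x|) - (Real.log |deriv f^[0] (y.1 0)|)| = 0 := by
      simp
    exact ⟨h0, h1, fun x _ => by rw [h2]; simp,
      fun x hx => hf.abs_sub_lt_of_distortion_le hs h0 h1 (fun x _ => by rw [h2]; norm_num) hx⟩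
  | succ n ih =>
    obtain ⟨hd, hy, hl, hb⟩ := ih
    have hn : distortionBound f C ε y s n ≤ 1 / 2 :=
      (Finset.single_le_sum (f := distortionBound f C ε y s)
        (fun i _ => hf.distortionBound_nonneg y hs.le i) (Finset.self_mem_range_succ n)).trans
        (hsum (n + 1))
    obtain ⟨hWf, hstep⟩ := hf.branch_step hj hn hb
    have hd' : IsC1Diffeo f^[n + 1] _ _ := hd.comp ((hf.basic.diffeo (j n)).restrict hd.1 hWf)
    have hy' : y.1 (n + 1) ∈ Ioo (p (j n)) (q (j n)) ∩
        f ⁻¹' branchPullback p q f j (Metric.ball y.proj s) n :=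
      ⟨hj n, by rwa [mem_preimage, (y.2 n).2]⟩
    have hlog : ∀ x ∈ Ioo (p (j n)) (q (j n)) ∩
        f ⁻¹' branchPullback p q f j (Metric.ball y.proj s) n,
        Real.log |deriv f^[n + 1] x| = (Real.log |deriv f^[n] (f x)|) + Real.log |deriv f x| := by
      intro x hx
      have h1 : deriv f^[n + 1] x = deriv f^[n] (f x) * deriv f x :=
        ((hd.differentiableAt hx.2).hasDerivAt.comp x
          ((hf.basic.diffeo (j n)).differentiableAt hx.1).hasDerivAt).deriv
      rw [h1, abs_mul, Real.log_mul (abs_ne_zero.2 (hd.deriv_ne_zero hx.2))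
        (abs_ne_zero.2 (hf.deriv_ne_zero hx.1))]
    have hl' : ∀ x ∈ Ioo (p (j n)) (q (j n)) ∩
        f ⁻¹' branchPullback p q f j (Metric.ball y.proj s) n,
        |(Real.log |deriv f^[n + 1] x|) - (Real.log |deriv f^[n + 1] (y.1 (n + 1))|)| ≤
          ∑ i ∈ Finset.range (n + 1), distortionBound f C ε y s i := by
      intro x hx
      rw [hlog x hx, hlog _ hy', (y.2 n).2, add_sub_add_comm, Finset.sum_range_succ]
      exact (abs_add_le _ _).trans (add_le_add (hl _ hx.2) (hstep x hx))
    exact ⟨hd', hy', hl', fun x hx => hf.abs_sub_lt_of_distortion_le hs hd' hy'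
      (fun x hx => (hl' x hx).trans (hsum _)) hx⟩

theorem exists_pullback_of_distortionBound (hf : IsCuspMapWith a b p q f C ε)
    (y : BackwardOrbit (cuspDomain p q) f) (hs : 0 < s)
    (hsum : ∀ n, ∑ i ∈ Finset.range n, distortionBound f C ε y s i ≤ 1 / 2) :
    ∃ V : Set (BackwardOrbit (cuspDomain p q) f),
      (y ∈ V ∧ BackwardOrbit.proj '' V = Metric.ball y.proj s) ∧
      (∀ n : ℕ, IsC1Diffeo f^[n] (BackwardOrbit.proj '' (BackwardOrbit.Finv^[n] '' V))
        (BackwardOrbit.proj '' V)) ∧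
      (∀ y' ∈ V, ∀ n, |(Real.log |deriv f (BackwardOrbit.Finv^[n + 1] y').proj|) -
        (Real.log |deriv f (BackwardOrbit.Finv^[n + 1] y).proj|)| ≤ distortionBound f C ε y s n) ∧
      ∀ n, volume (BackwardOrbit.proj '' (BackwardOrbit.Finv^[n] '' V)) ≤
        ENNReal.ofReal (4 * s / |deriv f^[n] (y.1 n)|) := by
  choose j hj using fun n => mem_iUnion.1 (y.2 n).1
  have spec := hf.branchPullback_spec hs hj hsum
  have hle (n : ℕ) : distortionBound f C ε y s n ≤ 1 / 2 :=
    (Finset.single_le_sum (f := distortionBound f C ε y s)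
      (fun i _ => hf.distortionBound_nonneg y hs.le i) (Finset.self_mem_range_succ n)).trans
      (hsum (n + 1))
  set W := branchPullback p q f j (Metric.ball y.proj s)
  have hWD (n : ℕ) : W (n + 1) ⊆ cuspDomain p q ∩ f ⁻¹' W n := fun x hx =>
    ⟨mem_iUnion.2 ⟨j n, hx.1⟩, hx.2⟩
  have himg (n : ℕ) : BackwardOrbit.proj ''
      (BackwardOrbit.Finv^[n] '' {y : BackwardOrbit (cuspDomain p q) f | ∀ k, y.1 k ∈ W k}) = W n :=
    BackwardOrbit.proj_image_Finv_iterate (fun n => (spec n).1.2.2.1) hWD n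
  have himg0 : BackwardOrbit.proj ''
      {y : BackwardOrbit (cuspDomain p q) f | ∀ k, y.1 k ∈ W k} = Metric.ball y.proj s := by
    have h0 := himg 0
    rwa [Function.iterate_zero, image_id] at h0
  refine ⟨{y | ∀ k, y.1 k ∈ W k}, ⟨fun k => (spec k).2.1, himg0⟩, fun n => ?_, fun y' hy' n => ?_,
    fun n => ?_⟩
  · rw [himg, himg0]
    exact (spec n).1
  · rw [BackwardOrbit.proj_Finv_iterate, BackwardOrbit.proj_Finv_iterate]
    exact (hf.branch_step hj (hle n) (spec n).2.2.2).2 _ (hy' (n + 1))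
  · rw [himg]
    have hsub : W n ⊆ Metric.ball (y.1 n) (2 * s / |deriv f^[n] (y.1 n)|) := fun x hx =>
      (spec n).2.2.2 x hx
    refine (measure_mono hsub).trans_eq ?_
    rw [Real.volume_ball]
    congr 1
    ring

end Pullback

end IsCuspMapWith

/-! ### Exponential growth, the radius and the growth constant -/

theorem summable_exp_of_tendsto_div {a : ℕ → ℝ} {c : ℝ} (hc : c < 0)
    (h : Tendsto (fun n : ℕ => a n / n) atTop (𝓝 c)) : Summable fun n => Real.exp (a n) := by
  have hg : Summable fun n : ℕ => Real.exp (n * (c / 2)) :=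
    Real.summable_exp_nat_mul_iff.2 (by linarith)
  refine hg.of_norm_bounded_eventually_nat ?_
  filter_upwards [h.eventually_lt_const (by linarith : c < c / 2), eventually_gt_atTop 0]
    with n hn hn0
  have : (0 : ℝ) < n := by exact_mod_cast hn0
  rw [div_lt_iff₀ this] at hn
  rw [Real.norm_eq_abs, Real.abs_exp, Real.exp_le_exp]
  linarith

theorem tendsto_shift_div {L : ℕ → ℝ} {χ : ℝ} (h : Tendsto (fun n : ℕ => L n / n) atTop (𝓝 χ)) :
    Tendsto (fun n : ℕ => L (n + 1) / n) atTop (𝓝 χ) := by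
  have h1 := (tendsto_add_atTop_iff_nat 1).2 h
  have h2 : Tendsto (fun n : ℕ => 1 + 1 / (n : ℝ)) atTop (𝓝 (1 + 0)) :=
    tendsto_const_nhds.add tendsto_one_div_atTop_nhds_zero_nat
  have h3 := h1.mul h2
  rw [add_zero, mul_one] at h3
  refine h3.congr' ?_
  filter_upwards [eventually_gt_atTop 0] with n hn
  have : (0 : ℝ) < n := by exact_mod_cast hn
  push_cast
  field_simp

namespace IsCuspMapWith

variable {ι : Type*} {a b : ℝ} {p q : ι → ℝ} {f : ℝ → ℝ} {C ε : ℝ}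
  {y : BackwardOrbit (cuspDomain p q) f} {χ : ℝ}

theorem log_abs_deriv_iterate (hf : IsCuspMapWith a b p q f C ε)
    (y : BackwardOrbit (cuspDomain p q) f) (n : ℕ) :
    Real.log |deriv f^[n] (y.1 n)| = ∑ i ∈ Finset.range n, Real.log |deriv f (y.1 (i + 1))| := by
  rw [hf.abs_deriv_iterate, Real.log_prod]
  exact fun i _ => abs_ne_zero.2 (hf.deriv_ne_zero_of_mem_cuspDomain (y.2 i).1)

/-- The `n`-th bound is `2 C 4^ε exp (-ε L (n+1) + |L (n+1) - L n|)`. Divided by `n`, the exponent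
tends to `-εχ < 0`, because the increments of `L` are `o(n)`. -/
theorem summable_distortionBound (hf : IsCuspMapWith a b p q f C ε) (hχ : 0 < χ)
    (h : Tendsto (fun n : ℕ => (Real.log |deriv f^[n] (y.1 n)|) / n) atTop (𝓝 χ)) :
    Summable (distortionBound f C ε y 1) := by
  set L : ℕ → ℝ := fun n => Real.log |deriv f^[n] (y.1 n)| with hL
  have hsh := tendsto_shift_div h
  have hlim : Tendsto (fun n : ℕ => (-(ε * L (n + 1)) + |L (n + 1) - L n|) / n) atTop
      (𝓝 (-(ε * χ) + |χ - χ|)) := by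
    refine ((hsh.const_mul ε).neg.add (hsh.sub h).abs).congr fun n => ?_
    rw [← sub_div, abs_div, abs_of_nonneg (Nat.cast_nonneg n : (0 : ℝ) ≤ n)]
    ring
  rw [sub_self, abs_zero, add_zero] at hlim
  have := summable_exp_of_tendsto_div (by nlinarith [hf.ε_pos, mul_pos hf.ε_pos hχ]) hlim
  refine (this.mul_left (2 * C * 4 ^ ε)).congr fun n => ?_
  have h1 := hf.abs_deriv_iterate_pos y (n + 1)
  have h2 : L (n + 1) - L n = Real.log |deriv f (y.1 (n + 1))| := by
    simp only [hL, hf.log_abs_deriv_iterate, Finset.sum_range_succ, add_sub_cancel_left]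
  have h3 : Real.exp (-(ε * L (n + 1))) = (|deriv f^[n + 1] (y.1 (n + 1))| ^ ε)⁻¹ := by
    rw [Real.exp_neg, Real.rpow_def_of_pos h1, mul_comm]
  rw [h2, Real.exp_add, h3, distortionBound, Real.div_rpow (by norm_num) h1.le, mul_one]
  ring

/-- Both terms decay at exponential rate `-η`. Their sum is a measurable quantity that dominates
every single term, which is what the constant `ρ` requires. -/
theorem summable_growth (hf : IsCuspMapWith a b p q f C ε)
    (h : Tendsto (fun n : ℕ => (Real.log |deriv f^[n] (y.1 n)|) / n) atTop (𝓝 χ)) {η : ℝ}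
    (hη : 0 < η) : Summable fun n : ℕ =>
      |deriv f^[n] (y.1 n)| * Real.exp (-(n * (χ + η))) +
        Real.exp (n * (χ - η)) / |deriv f^[n] (y.1 n)| := by
  refine Summable.add ?_ ?_
  · have hl : Tendsto (fun n : ℕ => ((Real.log |deriv f^[n] (y.1 n)|) - n * (χ + η)) / n) atTop
        (𝓝 (χ - (χ + η))) := by
      refine (h.sub_const (χ + η)).congr' ?_
      filter_upwards [eventually_ne_atTop 0] with n hn
      field_simp
    refine (summable_exp_of_tendsto_div (by linarith) hl).congr fun n => ?_
    rw [sub_eq_add_neg, Real.exp_add, Real.exp_log (hf.abs_deriv_iterate_pos y n)]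
  · have hl : Tendsto (fun n : ℕ => (n * (χ - η) - (Real.log |deriv f^[n] (y.1 n)|)) / n) atTop
        (𝓝 (χ - η - χ)) := by
      refine (h.const_sub (χ - η)).congr' ?_
      filter_upwards [eventually_ne_atTop 0] with n hn
      field_simp
    refine (summable_exp_of_tendsto_div (by linarith) hl).congr fun n => ?_
    rw [Real.exp_sub, Real.exp_log (hf.abs_deriv_iterate_pos y n)]

/-- The radius of a neighbourhood to which all inverse branches along `y` extend. -/
noncomputable def pullbackRadius (f : ℝ → ℝ) (C ε : ℝ) {D : Set ℝ} (y : BackwardOrbit D f) : ℝ :=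
  min (1 / 4) ((1 / (2 * (∑' n, distortionBound f C ε y 1 n + 1))) ^ (1 / ε))

/-- A bound for the deviation of `|Dfⁿ|` along `y` from exponential growth at rate `χ`. -/
noncomputable def growthBound (f : ℝ → ℝ) (χ : ℝ) {D : Set ℝ} (η : ℝ) (y : BackwardOrbit D f) : ℝ :=
  1 + 2 * ∑' n : ℕ, (|deriv f^[n] (y.1 n)| * Real.exp (-(n * (χ + η))) +
    Real.exp (n * (χ - η)) / |deriv f^[n] (y.1 n)|)

theorem measurable_abs_deriv_iterate {D : Set ℝ} (n : ℕ) :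
    Measurable fun y : BackwardOrbit D f => |deriv f^[n] (y.1 n)| :=
  ((measurable_deriv f^[n]).comp ((measurable_pi_apply n).comp measurable_subtype_coe)).norm

theorem measurable_distortionBound {D : Set ℝ} (s : ℝ) (n : ℕ) :
    Measurable fun y : BackwardOrbit D f => distortionBound f C ε y s n := by
  have h1 := measurable_abs_deriv_iterate (f := f) (D := D) (n + 1)
  have h2 : Measurable fun y : BackwardOrbit D f => deriv f (y.1 (n + 1)) :=
    (measurable_deriv f).comp ((measurable_pi_apply (n + 1)).comp measurable_subtype_coe)
  unfold distortionBound
  exact ((((measurable_const.div h1).pow_const ε).const_mul C).mul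
    h2.norm.log.norm.exp).const_mul 2

theorem measurable_pullbackRadius {D : Set ℝ} :
    Measurable (pullbackRadius f C ε : BackwardOrbit D f → ℝ) := by
  have h : Measurable fun y : BackwardOrbit D f => ∑' n, distortionBound f C ε y 1 n :=
    Measurable.tsum fun n => measurable_distortionBound 1 n
  unfold pullbackRadius
  exact measurable_const.min ((measurable_const.div ((h.add_const 1).const_mul 2)).pow_const _)

theorem measurable_growthBound {D : Set ℝ} (η : ℝ) :
    Measurable (growthBound f χ η : BackwardOrbit D f → ℝ) := by
  unfold growthBound
  refine (Measurable.const_mul (Measurable.tsum fun n => ?_) 2).const_add 1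
  have h1 := measurable_abs_deriv_iterate (f := f) (D := D) n
  exact (h1.mul_const _).add (measurable_const.div h1)

theorem pullbackRadius_pos (hf : IsCuspMapWith a b p q f C ε)
    (y : BackwardOrbit (cuspDomain p q) f) : 0 < pullbackRadius f C ε y := by
  have : 0 ≤ ∑' n, distortionBound f C ε y 1 n :=
    tsum_nonneg fun n => hf.distortionBound_nonneg y zero_le_one n
  unfold pullbackRadius
  positivity

/-- The value `1/4` gives more than `α < 1/2`: it absorbs the factor `4` in the length bound `4s /
|Dfⁿ|`. -/
theorem pullbackRadius_le {D : Set ℝ} (y : BackwardOrbit D f) : pullbackRadius f C ε y ≤ 1 / 4 :=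
  min_le_left _ _

theorem sum_distortionBound_pullbackRadius_le (hf : IsCuspMapWith a b p q f C ε)
    (hy : Summable (distortionBound f C ε y 1)) :
    Summable (distortionBound f C ε y (pullbackRadius f C ε y)) ∧
      ∑' n, distortionBound f C ε y (pullbackRadius f C ε y) n ≤ 1 / 2 := by
  have hα := (hf.pullbackRadius_pos y).le
  have e : distortionBound f C ε y (pullbackRadius f C ε y) =
      fun n => pullbackRadius f C ε y ^ ε * distortionBound f C ε y 1 n :=
    funext fun n => distortionBound_eq_mul y hα n
  rw [e]
  refine ⟨hy.mul_left _, ?_⟩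
  rw [tsum_mul_left]
  have h0 : 0 ≤ ∑' n, distortionBound f C ε y 1 n :=
    tsum_nonneg fun n => hf.distortionBound_nonneg y zero_le_one n
  -- With `S` the sum at scale `1`, this yields `α^ε S ≤ S / (2(S + 1)) ≤ 1/2`; the added `1` keeps
  -- the denominator positive when `S = 0`.
  have h1 : pullbackRadius f C ε y ^ ε ≤ 1 / (2 * (∑' n, distortionBound f C ε y 1 n + 1)) := by
    refine (Real.rpow_le_rpow hα (min_le_right _ _) hf.ε_pos.le).trans_eq ?_
    rw [← Real.rpow_mul (by positivity), one_div_mul_cancel hf.ε_pos.ne', Real.rpow_one]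
  refine (mul_le_mul_of_nonneg_right h1 h0).trans ?_
  rw [div_mul_eq_mul_div, div_le_iff₀ (by positivity)]
  linarith

theorem growthBound_pos {D : Set ℝ} (η : ℝ) (y : BackwardOrbit D f) : 0 < growthBound f χ η y := by
  have : 0 ≤ ∑' n : ℕ, (|deriv f^[n] (y.1 n)| * Real.exp (-(n * (χ + η))) +
      Real.exp (n * (χ - η)) / |deriv f^[n] (y.1 n)|) := tsum_nonneg fun n => by positivity
  unfold growthBound
  positivity

theorem growthBound_spec (hf : IsCuspMapWith a b p q f C ε)
    (h : Tendsto (fun n : ℕ => (Real.log |deriv f^[n] (y.1 n)|) / n) atTop (𝓝 χ)) {η : ℝ}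
    (hη : 0 < η) (n : ℕ) :
    (growthBound f χ η y)⁻¹ * Real.exp (n * (χ - η)) < |deriv f^[n] (y.1 n)| ∧
      |deriv f^[n] (y.1 n)| < growthBound f χ η y * Real.exp (n * (χ + η)) ∧
      1 / |deriv f^[n] (y.1 n)| ≤ growthBound f χ η y * Real.exp (-(n * (χ - η))) := by
  have hD := hf.abs_deriv_iterate_pos y n
  have hT := (hf.summable_growth h hη).le_tsum n fun k _ => by positivity
  -- One term is at most the whole sum `T ≥ 0`, and `T < 1 + 2T` gives strictness.
  have hρ : |deriv f^[n] (y.1 n)| * Real.exp (-(n * (χ + η))) +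
      Real.exp (n * (χ - η)) / |deriv f^[n] (y.1 n)| < growthBound f χ η y := by
    refine hT.trans_lt ?_
    have : 0 ≤ ∑' n : ℕ, (|deriv f^[n] (y.1 n)| * Real.exp (-(n * (χ + η))) +
      Real.exp (n * (χ - η)) / |deriv f^[n] (y.1 n)|) := tsum_nonneg fun n => by positivity
    unfold growthBound
    linarith
  have hρ0 := growthBound_pos (χ := χ) η y
  have h1 : |deriv f^[n] (y.1 n)| * Real.exp (-(n * (χ + η))) < growthBound f χ η y := by
    have : 0 < Real.exp (n * (χ - η)) / |deriv f^[n] (y.1 n)| := by positivity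
    linarith
  have h2 : Real.exp (n * (χ - η)) / |deriv f^[n] (y.1 n)| < growthBound f χ η y := by
    have : 0 < |deriv f^[n] (y.1 n)| * Real.exp (-(n * (χ + η))) := by positivity
    linarith
  rw [div_lt_iff₀ hD] at h2
  rw [Real.exp_neg, ← div_eq_mul_inv, div_lt_iff₀ (Real.exp_pos _)] at h1
  refine ⟨by rwa [inv_mul_lt_iff₀ hρ0], h1, ?_⟩
  rw [Real.exp_neg, ← div_eq_mul_inv, div_le_div_iff₀ hD (Real.exp_pos _), one_mul]
  exact h2.le

end IsCuspMapWith

/-! ### The theorem -/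

theorem measurableSet_cuspDomain {ι : Type*} [Countable ι] (p q : ι → ℝ) :
    MeasurableSet (cuspDomain p q) := MeasurableSet.iUnion fun _ => measurableSet_Ioo

theorem theorem16 {ι : Type*} [Countable ι] (a b : ℝ) (p q : ι → ℝ) (f : ℝ → ℝ)
    (hf : IsCuspMap a b p q f)
    (μ : Measure ℝ) (hμ : IsErgodicInvariant (cuspDomain p q) f μ)
    (hint : Integrable (fun x => Real.log |deriv f x|) μ)
    (χ : ℝ) (hχ : χ = ∫ x, Real.log |deriv f x| ∂μ) (hχ_pos : 0 < χ)
    (μbar : Measure (BackwardOrbit (cuspDomain p q) f))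
    (hμbar : IsNaturalExtension (cuspDomain p q) f μ μbar) :
    ∃ α : BackwardOrbit (cuspDomain p q) f → ℝ,
      Measurable α ∧ (∀ᵐ y ∂μbar, 0 < α y ∧ α y < 1 / 2) ∧
      ∃ ρ : ℝ → BackwardOrbit (cuspDomain p q) f → ℝ,
        (∀ η > 0, Measurable (ρ η) ∧ ∀ᵐ y ∂μbar, 0 < ρ η y) ∧
        ∀ᵐ y ∂μbar, ∃ V : Set (BackwardOrbit (cuspDomain p q) f),
          (y ∈ V ∧ BackwardOrbit.proj '' V = Metric.ball y.proj (α y)) ∧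
          (∀ n : ℕ, 0 < n →
            IsC1Diffeo f^[n] (BackwardOrbit.proj '' (BackwardOrbit.Finv^[n] '' V))
              (BackwardOrbit.proj '' V)) ∧
          (∀ y' ∈ V,
            Summable (fun i : ℕ =>
              |(Real.log |deriv f (BackwardOrbit.Finv^[i + 1] y').proj|) -
                (Real.log |deriv f (BackwardOrbit.Finv^[i + 1] y).proj|)|) ∧
            ∑' i : ℕ, |(Real.log |deriv f (BackwardOrbit.Finv^[i + 1] y').proj|) -
                (Real.log |deriv f (BackwardOrbit.Finv^[i + 1] y).proj|)| < Real.log 2) ∧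
          (∀ η > 0, ∀ n : ℕ,
            (ρ η y)⁻¹ * Real.exp (n * (χ - η)) < |deriv f^[n] (BackwardOrbit.Finv^[n] y).proj| ∧
            |deriv f^[n] (BackwardOrbit.Finv^[n] y).proj| < ρ η y * Real.exp (n * (χ + η)) ∧
            volume (BackwardOrbit.proj '' (BackwardOrbit.Finv^[n] '' V)) ≤
              ENNReal.ofReal (ρ η y * Real.exp (-(n * (χ - η))))) := by
  obtain ⟨C, ε, hf⟩ := hf
  have hD := measurableSet_cuspDomain p q
  have hfc : ContinuousOn f (cuspDomain p q) := fun x hx =>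
    (hf.differentiableAt hx).continuousAt.continuousWithinAt
  classical
  obtain ⟨g, hg, hgf⟩ : ∃ g : ℝ → ℝ, Measurable g ∧ EqOn g f (cuspDomain p q) :=
    ⟨(cuspDomain p q).piecewise f 0, hfc.measurable_piecewise continuousOn_const hD,
      piecewise_eqOn _ _ _⟩
  have hlim := ae_tendsto_backward_average hD hg hgf hμ hμbar (measurable_deriv f).norm.log hint
  refine ⟨IsCuspMapWith.pullbackRadius f C ε, IsCuspMapWith.measurable_pullbackRadius,
    ae_of_all _ fun y => ⟨hf.pullbackRadius_pos y, (IsCuspMapWith.pullbackRadius_le y).trans_lt (by norm_num)⟩,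
    IsCuspMapWith.growthBound f χ, fun η _ => ⟨IsCuspMapWith.measurable_growthBound η, ae_of_all _ fun y =>
      IsCuspMapWith.growthBound_pos η y⟩, ?_⟩
  -- The only exceptional null set comes from the ergodic theorem, so it is the same for all `η`.
  filter_upwards [hlim] with y hy
  have hy : Tendsto (fun n : ℕ => (Real.log |deriv f^[n] (y.1 n)|) / n) atTop (𝓝 χ) := by
    simp only [hf.log_abs_deriv_iterate, hχ]
    exact hy
  obtain ⟨hs, hs2⟩ := hf.sum_distortionBound_pullbackRadius_le (hf.summable_distortionBound hχ_pos hy)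
  have hα := hf.pullbackRadius_pos y
  obtain ⟨V, hV, hVd, hVl, hVv⟩ := hf.exists_pullback_of_distortionBound y hα fun n =>
    (hs.sum_le_tsum _ fun i _ => hf.distortionBound_nonneg y hα.le i).trans hs2
  refine ⟨V, hV, fun n _ => hVd n, fun y' hy' => ?_, fun η hη n => ?_⟩
  · have hsum := hs.of_nonneg_of_le (fun n => abs_nonneg _) (hVl y' hy')
    refine ⟨hsum, (hsum.tsum_le_tsum (hVl y' hy') hs).trans_lt ?_⟩
    linarith [Real.log_two_gt_d9]
  · obtain ⟨h1, h2, h3⟩ := hf.growthBound_spec hy hη n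
    rw [BackwardOrbit.proj_Finv_iterate]
    refine ⟨h1, h2, (hVv n).trans (ENNReal.ofReal_le_ofReal (le_trans ?_ h3))⟩
    refine div_le_div_of_nonneg_right ?_ (abs_nonneg _)
    linarith [IsCuspMapWith.pullbackRadius_le (C := C) (ε := ε) y]
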